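/- **Setting.** Let $\alpha>0$, $\Phi_\alpha^{-1}(y)=(\ln(1/y))^{-1/\alpha}$ (the quantile function of the standard $\alpha$-Fréchet law), $C_\alpha=\alpha(1+1/\alpha)^{1+1/\alpha}e^{-(1+1/\alpha)}$ and $\|f\|_\alpha=(\sum_i f(i)^\alpha)^{1/\alpha}$. For an integer $L\ge 1$ let $V_L=\{p/q: p,q\in\{0,\dots,L\},\ q\neq 0\}$. For $\gamma>0$ and $u\in(0,1)$ let $\tilde u$ be a multiple of $1/L$ in $[\gamma,1-\gamma]$ nearest to $u$, and let $\tilde z(u)$ be an element of $V_L$, multiple of $1/L$, nearest to $\Phi_\alpha^{-1}(\tilde u)$. The discretization has precision $\beta$ if $|\tilde z(u)-\Phi_\alpha^{-1}(u)|\le\beta$ for all $u\in[\gamma,1-\gamma]$. Given variables $Z_j(i)\ge 0$ $(1\le j\le K,\ 1\le i\le N)$, the max-stable sketch of a signal $f$ is $E_j(f)=\max_i f(i)Z_j(i)$, and the point estimator is $\hat f(i_0)=\min_j E_j(f)/Z_j(i_0)$ (over the $j$ with $Z_j(i_0)\ne 0$; it is $0$ if there are none). Streams are sequences of pairs $(i,a)$,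 and $f(i)$ is the largest $a$ observed with $i$ ($0$ if there is none); this includes the aggregate model, where each index occurs at most once. Algorithms run on a random access machine with $b$-bit words. An instruction is a copy, a direct or indirect memory access, a test, an arithmetic, comparison, shift or bitwise operation on words, or an evaluation of the discretized quantile $k/L\mapsto\tilde z(k/L)$. Each instruction is charged $b$ bit operations, and a memory of $m$ words takes $mb$ bits, including the random bits. **Theorem.** For every $\alpha>0$ there are a constant $\kappa\ge 1$ and a fixed pair of programs (update, query) such that for all $c>0$ and $\delta_0<1$ there is a constant $C$, depending only on $\alpha,c,\delta_0$, with the following property. Let $N\ge 2$, $\epsilon\in(0,(\alpha/(\alpha+1))^{1/\alpha^2})$, $\delta\in(0,\delta_0]$, $D>0$, $K=\lceil\kappa\ln(1/\delta)/\epsilon^\alpha\rceil$ and $0<\gamma<\delta/(4KN)$. Let $L\ge1$ satisfy $\log_2 L\le c\log_2(DN/(\epsilon\delta))$, and let the discretization have a precision $\beta\le\epsilon^\alpha/(D+1)$. Then, for suitable word length and memory, a bounded number of precomputed words that depend only on these parameters, and uniformly random words kept in memory: 1. *(Pseudorandom Fréchet variables.)* There is $B$ with $2^B\ge L^2$ such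 that the random words determine $B$-bit words $w_j(i)$, $1\le j\le K$, $1\le i\le N$, each uniformly distributed on $\{0,\dots,2^B-1\}$. Put $\hat Z_j(i)=\tilde z\big((w_j(i)+\tfrac12)/2^B\big)$. 2. *(Algorithm.)* For every signal $f:\{1,\dots,N\}\to\{0,\dots,L\}$, every stream that produces $f$ and every outcome of the random words, the algorithm reads the stream and then, for every query $i_0$, outputs exactly the point estimate $\hat f(i_0)$ based on the $\hat Z_j(i)$. 3. *(Accuracy.)* For every $f:\{1,\dots,N\}\to\{0,\dots,L\}$ and $i_0$ with $$2(1+C_\alpha)\,\epsilon\,\|f\|_\alpha\le f(i_0)\le D\Big(\sum_{i\ne i_0}f(i)^\alpha\Big)^{1/\alpha}$$ one has $\mathbb P\{\hat f(i_0)=f(i_0)\}\ge 1-3\delta$. 4. *(Complexity.)* The total space in bits and the number of bit operations per stream item are each at most $$C\,\frac{\log_2(DN/(\epsilon\delta))\,\log_2 N\,\ln(1/\delta)}{\epsilon^\alpha}.$$ -/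

import Mathlib

open Finset

noncomputable section

/-! ### Discretised Fréchet variables -/

/-- The quantile function `Φ_α⁻¹(y) = (ln (1/y))^(-1/α)` of the standard `α`-Fréchet law. -/
def frechetQuantile (α y : ℝ) : ℝ := Real.log (1 / y) ^ (-(1 / α))

/-- The set `V_L = {p / q : p, q ∈ {0, …, L}, q ≠ 0}`. -/
def ratSet (L : ℕ) : Finset ℚ≥0 :=
  (range (L + 1) ×ˢ Icc 1 L).image fun pq => (pq.1 : ℚ≥0) / (pq.2 : ℚ≥0)

/-- The elements of `V_L` that are multiples of `1 / L`. -/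
def ratGrid (L : ℕ) : Finset ℚ≥0 := (ratSet L).filter fun x => (x * L).den = 1

/-- An element of the finite set `S` that is nearest to the real number `x`. -/
def nearest (S : Finset ℚ≥0) (x : ℝ) : ℚ≥0 :=
  if h : S.Nonempty then (S.exists_min_image (fun s => |(s : ℝ) - x|) h).choose else 0

/-- The discretised value of the quantile function at the grid point `k / L`. -/
def discQuantile (α : ℝ) (L k : ℕ) : ℚ≥0 := nearest (ratGrid L) (frechetQuantile α (k / L))

/-- The integer `k` for which `k / L` is the multiple of `1 / L` in `[γ, 1 - γ]` that is nearest
to `u` (round, then clamp). -/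
def gridIndex (L : ℕ) (γ u : ℝ) : ℕ :=
  min (max ⌊u * L + 1 / 2⌋₊ ⌈γ * L⌉₊) ⌊(1 - γ) * L⌋₊

/-- The discretised Fréchet variable `Z̃`, as a function of the value `u` of the uniform
variable `U` behind it. -/
def discFrechet (α : ℝ) (L : ℕ) (γ u : ℝ) : ℚ≥0 := discQuantile α L (gridIndex L γ u)

/-- `β` is a precision of the discretisation:
`|Z̃ - Z| ≤ β`, where `Z = Φ_α⁻¹(U)`, whenever `U ∈ [γ, 1 - γ]`. -/
def HasPrecision (α : ℝ) (L : ℕ) (γ β : ℝ) : Prop :=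
  ∀ u ∈ Set.Icc γ (1 - γ), |(discFrechet α L γ u : ℝ) - frechetQuantile α u| ≤ β

/-! ### Max-stable sketches and the point estimator -/

/-- The max-stable sketch `E_j(f) = max_i f(i) Z_j(i)`. -/
def sketch {N K : ℕ} (f : Fin N → ℕ) (Z : Fin K → Fin N → ℚ≥0) (j : Fin K) : ℚ≥0 :=
  univ.sup fun i => (f i : ℚ≥0) * Z j i

/-- The point estimator `min_j E_j(f) / Z_j(i₀)`; rows with `Z_j(i₀) = 0`, for which the quotient
is not defined, are left out. -/
def pointEstimate {N K : ℕ} (f : Fin N → ℕ) (Z : Fin K → Fin N → ℚ≥0) (i₀ : Fin N) : ℚ≥0 :=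
  if h : (univ.filter fun j => Z j i₀ ≠ 0).Nonempty then
    (univ.filter fun j => Z j i₀ ≠ 0).inf' h fun j => sketch f Z j / Z j i₀
  else 0

/-- The constant `C_α = α (1 + 1/α)^(1 + 1/α) e^{-(1 + 1/α)}`. -/
def frechetConst (α : ℝ) : ℝ :=
  α * (1 + 1 / α) ^ (1 + 1 / α) * Real.exp (-(1 + 1 / α))

/-- `2 (1 + C_α) ε ‖f‖_α ≤ f(i₀) ≤ D (∑_{i ≠ i₀} f(i)^α)^{1/α}`. -/
def IsLargeAt {N : ℕ} (α ε D : ℝ) (f : Fin N → ℕ) (i₀ : Fin N) : Prop :=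
  2 * (1 + frechetConst α) * ε * (∑ i, (f i : ℝ) ^ α) ^ (1 / α) ≤ f i₀ ∧
    (f i₀ : ℝ) ≤ D * (∑ i ∈ univ.erase i₀, (f i : ℝ) ^ α) ^ (1 / α)

/-- The stream of pairs `(i, a)` produces the signal `f`: `f(i)` is the largest value that was
observed with the index `i`, and `0` if there is none. If every index occurs at most once
(aggregate model), `f(i)` is the value that was observed with `i`. -/
def IsStreamOf {N : ℕ} (S : List (Fin N × ℕ)) (f : Fin N → ℕ) : Prop :=
  ∀ i, (∀ a, (i, a) ∈ S → a ≤ f i) ∧ ((i, f i) ∈ S ∨ ((∀ a, (i, a) ∉ S) ∧ f i = 0))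

/-- The probability of an event under the uniform distribution on a finite set. -/
def unifProb {Ω : Type} (p : Ω → Prop) : ℝ := (Nat.card {ω // p ω} : ℝ) / Nat.card Ω

/-! ### A random access machine with words of `b` bits

The memory consists of `m` words of `b` bits, that is, of `m * b` bits, and a program is a fixed
finite text. An instruction acts on a bounded number of words and is charged `b` bit operations,
so that a run of `t` steps performs `t * b` of them. -/

/-- The contents of `m` memory cells of `b` bits each. -/
abbrev Memory (m b : ℕ) : Type := Fin m → Fin (2 ^ b)

/-- The word in the cell with address `a` (`0` if there is no such cell). -/
def Memory.get {m b : ℕ} (s : Memory m b) (a : ℕ) : ℕ := if h : a < m then (s ⟨a, h⟩ : ℕ) else 0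

/-- Write `v`, modulo `2 ^ b`, to the cell with address `a` (no effect if there is none). -/
def Memory.set {m b : ℕ} (s : Memory m b) (a v : ℕ) : Memory m b :=
  fun x => if (x : ℕ) = a then Fin.ofNat (2 ^ b) v else s x

/-- The binary operations on words. -/
inductive WordOp
  | add | sub | mul | div | mod | and | or | xor | shiftLeft | shiftRight | lt | eq

def WordOp.eval : WordOp → ℕ → ℕ → ℕ
  | .add, x, y => x + y
  | .sub, x, y => x - y
  | .mul, x, y => x * y
  | .div, x, y => x / y
  | .mod, x, y => x % y
  | .and, x, y => x &&& y
  | .or, x, y => x ||| y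
  | .xor, x, y => x ^^^ y
  | .shiftLeft, x, y => x <<< y
  | .shiftRight, x, y => x >>> y
  | .lt, x, y => if x < y then 1 else 0
  | .eq, x, y => if x = y then 1 else 0

/-- Programs; the arguments are addresses of cells, except for the constant `v` in `const d v`.
With `M` for the memory:
`skip` does nothing;
`const d v` is `M[d] := v`;
`op o d x y` is `M[d] := M[x] o M[y]`;
`load d x` is `M[d] := M[M[x]]`;
`store d x` is `M[M[d]] := M[x]`;
`quantile d e x` computes the discretised Fréchet quantile at the grid point with index `M[x]`
and writes its numerator to `M[d]` and its denominator to `M[e]`;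
`seq`, `ite` and `loop` are composition, a branch on `M[x] ≠ 0`, and a loop while `M[x] ≠ 0`. -/
inductive Cmd
  | skip
  | const (d v : ℕ)
  | op (o : WordOp) (d x y : ℕ)
  | load (d x : ℕ)
  | store (d x : ℕ)
  | quantile (d e x : ℕ)
  | seq (p₁ p₂ : Cmd)
  | ite (x : ℕ) (p₁ p₂ : Cmd)
  | loop (x : ℕ) (p : Cmd)

/-- `Exec q p s t s'`: started in the memory `s`, the program `p` halts after `t` steps with the
memory `s'`. Here `q k` is the discretised quantile at the grid point with index `k`. -/
inductive Exec {m b : ℕ} (q : ℕ → ℚ≥0) : Cmd → Memory m b → ℕ → Memory m b → Prop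
  | skip (s : Memory m b) : Exec q .skip s 1 s
  | const (s : Memory m b) (d v : ℕ) : Exec q (.const d v) s 1 (s.set d v)
  | op (s : Memory m b) (o : WordOp) (d x y : ℕ) :
      Exec q (.op o d x y) s 1 (s.set d (o.eval (s.get x) (s.get y)))
  | load (s : Memory m b) (d x : ℕ) : Exec q (.load d x) s 1 (s.set d (s.get (s.get x)))
  | store (s : Memory m b) (d x : ℕ) : Exec q (.store d x) s 1 (s.set (s.get d) (s.get x))
  | quantile (s : Memory m b) (d e x : ℕ) :
      Exec q (.quantile d e x) s 1
        ((s.set d (q (s.get x)).num).set e (q (s.get x)).den)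
  | seq {p₁ p₂ : Cmd} {s s₁ s₂ : Memory m b} {t₁ t₂ : ℕ}
      (h₁ : Exec q p₁ s t₁ s₁) (h₂ : Exec q p₂ s₁ t₂ s₂) : Exec q (.seq p₁ p₂) s (t₁ + t₂) s₂
  | iteTrue {x : ℕ} {p₁ p₂ : Cmd} {s s₁ : Memory m b} {t : ℕ}
      (hx : s.get x ≠ 0) (h : Exec q p₁ s t s₁) : Exec q (.ite x p₁ p₂) s (1 + t) s₁
  | iteFalse {x : ℕ} {p₁ p₂ : Cmd} {s s₁ : Memory m b} {t : ℕ}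
      (hx : s.get x = 0) (h : Exec q p₂ s t s₁) : Exec q (.ite x p₁ p₂) s (1 + t) s₁
  | loopDone {x : ℕ} {p : Cmd} {s : Memory m b} (hx : s.get x = 0) : Exec q (.loop x p) s 1 s
  | loopStep {x : ℕ} {p : Cmd} {s s₁ s₂ : Memory m b} {t₁ t₂ : ℕ}
      (hx : s.get x ≠ 0) (h₁ : Exec q p s t₁ s₁) (h₂ : Exec q (.loop x p) s₁ t₂ s₂) :
      Exec q (.loop x p) s (1 + t₁ + t₂) s₂

/-- The memory before the stream starts: cells `0` and `1` are reserved for input and output, the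
next `h` cells hold the numerical parameters `hdr` of the algorithm, the next `R` cells hold the
random words `ω`, and all other cells are `0`. -/
def startMemory {m b B h R : ℕ} (hdr : Fin h → Fin (2 ^ b)) (ω : Fin R → Fin (2 ^ B)) :
    Memory m b := fun x =>
  if (x : ℕ) < 2 then 0
  else if h₁ : (x : ℕ) - 2 < h then hdr ⟨x - 2, h₁⟩
  else if h₂ : (x : ℕ) - 2 - h < R then Fin.ofNat (2 ^ b) (ω ⟨x - 2 - h, h₂⟩ : ℕ)
  else 0

/-- The update program reads the stream: for each item `(i, a)`, the numbers `i` and `a` are put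
into the cells `0` and `1`, and the program runs for at most `T` steps. The memory, `s` at first,
is `s'` in the end. -/
def ReadsStream {m b N : ℕ} (q : ℕ → ℚ≥0) (upd : Cmd) (T : ℕ) :
    List (Fin N × ℕ) → Memory m b → Memory m b → Prop
  | [], s, s' => s' = s
  | (i, a) :: S, s, s' => ∃ t s₁, t ≤ T ∧ Exec q upd ((s.set 0 i).set 1 a) t s₁ ∧
      ReadsStream q upd T S s₁ s'

/-- To the query `i₀`, put into cell `0`, the program `qry` answers with the number `y`, given by
its numerator in cell `0` and its denominator in cell `1`. -/
def Answers {m b : ℕ} (q : ℕ → ℚ≥0) (qry : Cmd) (s : Memory m b) (i₀ : ℕ) (y : ℚ≥0) : Prop :=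
  ∃ t s', Exec q qry (s.set 0 i₀) t s' ∧ s'.get 1 ≠ 0 ∧
    y = (s'.get 0 : ℚ≥0) / (s'.get 1 : ℚ≥0)

/-- The pseudorandom Fréchet variables `Ẑ_j(i)`: the discretised Fréchet variables that belong to
the uniform variables `(w_j(i) + 1/2) / 2^B`, where `w_j(i)` are pseudorandom `B`-bit words. -/
def pseudoFrechet {B N K : ℕ} (α : ℝ) (L : ℕ) (γ : ℝ) (w : Fin K → Fin N → Fin (2 ^ B))
    (j : Fin K) (i : Fin N) : ℚ≥0 :=
  discFrechet α L γ ((((w j i : ℕ) : ℝ) + 1 / 2) / 2 ^ B)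

end

noncomputable section

/-! ### Symbolic execution of loop-free programs -/

/-! Accuracy. Every usable row overestimates `f i₀`, because the term of `i₀` occurs in the maximum;
the minimum is therefore exact once `i₀` attains the maximum in a single usable row
(`pointEstimate_eq_of_dominates`). Let σ be the α-norm of `f` off `i₀`. With fixed s, a row is good
if the variable of `i₀` is at least (s+1)σ/f(i₀) and every other one is at most (s-1)σ/f(i). The gap
of 2σ absorbs the discretization error on both sides (`dominates_of_rowGood`). A union bound inside
the event for `i₀` uses only pairs of indices, so pairwise independence within a row gives a good
row probability of order ε^α (`le_unifProb_rowGood`). Rows are independent, so all K fail with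
probability at most δ; another δ pays for uniforms outside [γ, 1-γ].

Randomness. A row needs only n+1 random words, n = ⌈log₂ N⌉: the word of `i` is the first one plus
those selected by the binary digits of `i`. For two distinct indices this is a surjective
homomorphism onto pairs of words, and such maps preserve uniform distributions
(`rowHash_prod_surjective`, `unifProb_comp_addMonoidHom`).

Exact computation. Grid values are multiples of 1/L, so the machine works with L times each value,
and the point estimate becomes a minimum of integer quotients compared by cross-multiplication
(`SketchParams.implements`). No number overflows, so programs may be evaluated over unbounded
naturals (`Cmd.Safe.exec`).

Word length. The quantile at 1-γ is at least (2γ)^(-1/α), but grid values are at most L. The assumed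
precision thus bounds 1/γ, hence KN, by a power of L (`HasPrecision.inv_le`), and O(log L) bits
suffice for addresses as well as values. -/

theorem Memory.get_set {m b : ℕ} (s : Memory m b) {d v : ℕ} (hd : d < m) (hv : v < 2 ^ b) :
    (s.set d v).get = Function.update s.get d v := by
  funext a
  unfold Memory.get Memory.set
  by_cases had : a = d
  · subst had
    simp [hd, Nat.mod_eq_of_lt hv]
  · by_cases ham : a < m <;> simp [ham, had]

theorem Memory.get_lt {m b : ℕ} (s : Memory m b) (a : ℕ) : s.get a < 2 ^ b := by
  unfold Memory.get
  split_ifs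
  · exact Fin.isLt _
  · positivity

/-- The sequential composition of a list of programs. -/
def Cmd.block : List Cmd → Cmd
  | [] => .skip
  | p :: l => .seq p (Cmd.block l)

/-- The effect of a loop-free program on a memory whose words are unbounded. -/
def Cmd.eval (q : ℕ → ℚ≥0) : Cmd → (ℕ → ℕ) → ℕ → ℕ
  | .skip, g => g
  | .const d v, g => Function.update g d v
  | .op o d x y, g => Function.update g d (o.eval (g x) (g y))
  | .load d x, g => Function.update g d (g (g x))
  | .store d x, g => Function.update g (g d) (g x)
  | .quantile d e x, g => Function.update (Function.update g d (q (g x)).num) e (q (g x)).den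
  | .seq p₁ p₂, g => p₂.eval q (p₁.eval q g)
  | .ite x p₁ p₂, g => fun a => if g x = 0 then p₂.eval q g a else p₁.eval q g a
  -- A default value: `Cmd.Safe` rejects loops, which are handled by `Halts.loop`.
  | .loop _ _, g => g

/-- The program is loop-free, writes to existing cells only, and never overflows. -/
def Cmd.Safe (q : ℕ → ℚ≥0) (m b : ℕ) : Cmd → (ℕ → ℕ) → Prop
  | .skip, _ => True
  | .const d v, _ => d < m ∧ v < 2 ^ b
  | .op o d x y, g => d < m ∧ o.eval (g x) (g y) < 2 ^ b
  | .load d _, _ => d < m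
  | .store d _, g => g d < m
  | .quantile d e x, g => d < m ∧ e < m ∧ (q (g x)).num < 2 ^ b ∧ (q (g x)).den < 2 ^ b
  | .seq p₁ p₂, g => p₁.Safe q m b g ∧ p₂.Safe q m b (p₁.eval q g)
  | .ite x p₁ p₂, g => (g x ≠ 0 → p₁.Safe q m b g) ∧ (g x = 0 → p₂.Safe q m b g)
  | .loop _ _, _ => False

/-- A bound for the number of steps of a loop-free program. -/
def Cmd.cost : Cmd → ℕ
  | .seq p₁ p₂ => p₁.cost + p₂.cost
  | .ite _ p₁ p₂ => 1 + p₁.cost + p₂.cost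
  | _ => 1

/-- Started in the memory `s`, the program halts after at most `T` steps in a memory whose
contents satisfy `Q`. -/
def Halts {m b : ℕ} (q : ℕ → ℚ≥0) (p : Cmd) (s : Memory m b) (T : ℕ) (Q : (ℕ → ℕ) → Prop) :
    Prop :=
  ∃ t s', t ≤ T ∧ Exec q p s t s' ∧ Q s'.get

/-- When every write hits an existing cell with a value below 2^b, the reduction modulo 2^b never
acts. This turns correctness of straight-line code into simplification of `Cmd.eval` plus size
inequalities. -/
theorem Cmd.Safe.exec {m b : ℕ} {q : ℕ → ℚ≥0} {p : Cmd} {s : Memory m b}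
    (h : p.Safe q m b s.get) :
    ∃ t s', t ≤ p.cost ∧ Exec q p s t s' ∧ s'.get = p.eval q s.get := by
  induction p generalizing s with
  | skip => exact ⟨1, s, le_rfl, .skip s, rfl⟩
  | const d v => exact ⟨1, _, le_rfl, .const s d v, Memory.get_set s h.1 h.2⟩
  | op o d x y => exact ⟨1, _, le_rfl, .op s o d x y, Memory.get_set s h.1 h.2⟩
  | load d x => exact ⟨1, _, le_rfl, .load s d x, Memory.get_set s h (s.get_lt _)⟩
  | store d x => exact ⟨1, _, le_rfl, .store s d x, Memory.get_set s h (s.get_lt _)⟩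
  | quantile d e x =>
    refine ⟨1, _, le_rfl, .quantile s d e x, ?_⟩
    rw [Memory.get_set _ h.2.1 h.2.2.2, Memory.get_set _ h.1 h.2.2.1]
    rfl
  | seq p₁ p₂ ih₁ ih₂ =>
    obtain ⟨t₁, s₁, ht₁, e₁, g₁⟩ := ih₁ h.1
    obtain ⟨t₂, s₂, ht₂, e₂, g₂⟩ := ih₂ (s := s₁) (by rw [g₁]; exact h.2)
    exact ⟨_, s₂, add_le_add ht₁ ht₂, .seq e₁ e₂, by rw [g₂, g₁]; rfl⟩
  | ite x p₁ p₂ ih₁ ih₂ =>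
    by_cases hx : s.get x = 0
    · obtain ⟨t, s', ht, e, g⟩ := ih₂ (h.2 hx)
      exact ⟨_, s', by simp only [Cmd.cost]; omega, .iteFalse hx e, by simp [Cmd.eval, hx, g]⟩
    · obtain ⟨t, s', ht, e, g⟩ := ih₁ (h.1 hx)
      exact ⟨_, s', by simp only [Cmd.cost]; omega, .iteTrue hx e, by simp [Cmd.eval, hx, g]⟩
  | loop x p => exact h.elim

theorem Cmd.Safe.halts {m b : ℕ} {q : ℕ → ℚ≥0} {p : Cmd} {s : Memory m b} {T : ℕ}
    {Q : (ℕ → ℕ) → Prop} (h : p.Safe q m b s.get) (hT : p.cost ≤ T) (hQ : Q (p.eval q s.get)) :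
    Halts q p s T Q := by
  obtain ⟨t, s', ht, e, g⟩ := h.exec
  exact ⟨t, s', ht.trans hT, e, g ▸ hQ⟩

theorem Halts.seq {m b : ℕ} {q : ℕ → ℚ≥0} {p₁ p₂ : Cmd} {s : Memory m b} {T₁ T₂ T : ℕ}
    {Q₁ Q : (ℕ → ℕ) → Prop} (h₁ : Halts q p₁ s T₁ Q₁)
    (h₂ : ∀ s₁ : Memory m b, Q₁ s₁.get → Halts q p₂ s₁ T₂ Q) (hT : T₁ + T₂ ≤ T) :
    Halts q (.seq p₁ p₂) s T Q := by
  obtain ⟨t₁, s₁, ht₁, e₁, g₁⟩ := h₁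
  obtain ⟨t₂, s₂, ht₂, e₂, g₂⟩ := h₂ s₁ g₁
  exact ⟨_, s₂, by omega, .seq e₁ e₂, g₂⟩

/-- A loop that counts the cell `x` down to `0`. -/
theorem Halts.loop {m b : ℕ} {q : ℕ → ℚ≥0} {p : Cmd} {x T k : ℕ} (I : ℕ → (ℕ → ℕ) → Prop)
    (hx : ∀ k g, I k g → g x = k)
    (hstep : ∀ k (s : Memory m b), I (k + 1) s.get → Halts q p s T (I k))
    {s : Memory m b} (hs : I k s.get) : Halts q (.loop x p) s (k * (T + 1) + 1) (I 0) := by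
  induction k generalizing s with
  | zero => exact ⟨1, s, by omega, .loopDone (hx _ _ hs), hs⟩
  | succ k ih =>
    obtain ⟨t₁, s₁, ht₁, e₁, g₁⟩ := hstep k s hs
    obtain ⟨t₂, s₂, ht₂, e₂, g₂⟩ := ih g₁
    exact ⟨_, s₂, by rw [add_one_mul]; omega,
      .loopStep (by rw [hx _ _ hs]; omega) e₁ e₂, g₂⟩

/-! ### The programs -/

/-- The numerical parameters of the algorithm. -/
structure SketchParams where
  (K n B L lo hi : ℕ)

namespace SketchParams

/-- The address of the first sketch. -/
def base (P : SketchParams) : ℕ := 26 + P.K * (P.n + 1)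

/-- The word of row `j` and index `i`, as a function of the random words `r`. -/
def word (P : SketchParams) (r : ℕ → ℕ) (j i : ℕ) : ℕ :=
  (r (j * (P.n + 1)) + ∑ k ∈ range P.n, r (j * (P.n + 1) + 1 + k) * (i / 2 ^ k % 2)) % 2 ^ P.B

/-- The index of the grid point that belongs to the word `w`. -/
def index (P : SketchParams) (w : ℕ) : ℕ :=
  min (max (((2 * w + 1) * P.L + 2 ^ P.B) / 2 ^ (P.B + 1)) P.lo) P.hi

/-- `L` times the value `q (index w)`. -/
def scaled (P : SketchParams) (q : ℕ → ℚ≥0) (w : ℕ) : ℕ :=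
  (q (P.index w)).num * (P.L / (q (P.index w)).den)

/-- The contents of the read-only part of the memory. -/
structure Config (P : SketchParams) (r : ℕ → ℕ) (g : ℕ → ℕ) : Prop where
  one : g 2 = 1
  two : g 3 = 2
  zero : g 4 = 0
  rows : g 5 = P.K
  start : g 6 = 26
  sketches : g 7 = P.base
  bits : g 8 = P.n
  modulus : g 9 = 2 ^ P.B
  double : g 10 = 2 ^ (P.B + 1)
  grid : g 11 = P.L
  low : g 12 = P.lo
  high : g 13 = P.hi
  random : ∀ k < P.K * (P.n + 1), g (26 + k) = r k
  words : ∀ k < P.K * (P.n + 1), r k < 2 ^ P.B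

/-- Words and memory are large enough for the algorithm. -/
structure Fits (P : SketchParams) (q : ℕ → ℚ≥0) (m b : ℕ) : Prop where
  memory : P.base + P.K ≤ m
  address : m < 2 ^ b
  fine : 2 ^ (P.B + 2) * P.L < 2 ^ b
  values : P.L ^ 5 < 2 ^ b
  pos : 0 < P.L
  rows : 0 < P.K
  low : P.lo ≤ P.L
  high : P.hi ≤ P.L
  num : ∀ k, (q k).num ≤ P.L
  den : ∀ k, (q k).den ≤ P.L

variable {P : SketchParams} {r : ℕ → ℕ} {q : ℕ → ℚ≥0} {m b : ℕ}

/-- Cells 0 and 1 are for input and output, cells 14 to 25 are working cells, and the sketches start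
at `P.base`; writing there leaves the configuration intact. -/
theorem Config.congr {g g' : ℕ → ℕ} (h : P.Config r g) (h₁ : ∀ a, 2 ≤ a → a < 14 → g' a = g a)
    (h₂ : ∀ a, 26 ≤ a → a < P.base → g' a = g a) : P.Config r g' where
  one := by rw [h₁ _ (by norm_num) (by norm_num), h.one]
  two := by rw [h₁ _ (by norm_num) (by norm_num), h.two]
  zero := by rw [h₁ _ (by norm_num) (by norm_num), h.zero]
  rows := by rw [h₁ _ (by norm_num) (by norm_num), h.rows]
  start := by rw [h₁ _ (by norm_num) (by norm_num), h.start]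
  sketches := by rw [h₁ _ (by norm_num) (by norm_num), h.sketches]
  bits := by rw [h₁ _ (by norm_num) (by norm_num), h.bits]
  modulus := by rw [h₁ _ (by norm_num) (by norm_num), h.modulus]
  double := by rw [h₁ _ (by norm_num) (by norm_num), h.double]
  grid := by rw [h₁ _ (by norm_num) (by norm_num), h.grid]
  low := by rw [h₁ _ (by norm_num) (by norm_num), h.low]
  high := by rw [h₁ _ (by norm_num) (by norm_num), h.high]
  random k hk := by rw [h₂ _ (by omega) (by unfold base; omega), h.random k hk]
  words := h.words

/-- Source of the exponent 5 in `Fits.values`: scaled variables are at most L², sketches at most L³,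
and cross-multiplication takes one of each. -/
theorem scaled_le (hF : P.Fits q m b) (w : ℕ) : P.scaled q w ≤ P.L ^ 2 := by
  rw [sq]
  exact Nat.mul_le_mul (hF.num _) (Nat.div_le_self _ _)

/-- One step of the evaluation of the hash function: reads the random word at the address in
cell `20` and one binary digit of the index in cell `21`. -/
def bitProg : Cmd := .block
  [.load 24 20, .op .mod 25 21 3, .op .mul 24 24 25, .op .add 22 22 24, .op .mod 22 22 9,
    .op .div 21 21 3, .op .add 20 20 2, .op .sub 23 23 2]

/-- Computes the hash value of the index in cell `0` to cell `22`, with the random words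
from the address in cell `20` on. -/
def hashProg : Cmd := .seq (.block [.load 22 20, .op .add 21 0 4, .op .mod 22 22 9,
  .op .add 20 20 2, .op .add 23 8 4]) (.loop 23 bitProg)

/-- Computes the scaled discretised quantile that belongs to the word in cell `22` to
cell `25`. -/
def quantileProg : Cmd := .block
  [.op .add 22 22 22, .op .add 22 22 2, .op .mul 22 22 11, .op .add 22 22 9, .op .div 22 22 10,
    .op .sub 24 22 12, .op .add 22 12 24, .op .sub 24 22 13, .op .sub 22 22 24,
    .quantile 21 23 22, .op .div 24 11 23, .op .mul 25 21 24]

/-- Computes the scaled discretised Fréchet variable of the row in cell `20` and the index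
in cell `0`, and moves on to the next row. -/
def rowProg : Cmd := .seq hashProg quantileProg

/-- The digit is 0 or 1 and the accumulator is reduced after each addition, so intermediate values
stay below 2 · 2^B. The reference memory `g₀` is that of the start of the loop. -/
theorem bitProg_halts (hF : P.Fits q m b) {g₀ : ℕ → ℕ} (hc : P.Config r g₀) {i j : ℕ}
    (hj : j < P.K) (k : ℕ) (hk : k < P.n) {s : Memory m b}
    (hs : ∀ a, a < 20 ∨ 26 ≤ a → s.get a = g₀ a)
    (h20 : s.get 20 = 26 + (j * (P.n + 1) + 1 + k))
    (h21 : s.get 21 = i / 2 ^ k)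
    (h22 : s.get 22 = (r (j * (P.n + 1)) +
      ∑ k ∈ range k, r (j * (P.n + 1) + 1 + k) * (i / 2 ^ k % 2)) % 2 ^ P.B)
    (h23 : s.get 23 = P.n - k) :
    Halts q bitProg s 9 fun g => (∀ a, a < 20 ∨ 26 ≤ a → g a = g₀ a) ∧
      g 20 = 26 + (j * (P.n + 1) + 1 + (k + 1)) ∧ g 21 = i / 2 ^ (k + 1) ∧
      g 22 = (r (j * (P.n + 1)) +
        ∑ k ∈ range (k + 1), r (j * (P.n + 1) + 1 + k) * (i / 2 ^ k % 2)) % 2 ^ P.B ∧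
      g 23 = P.n - (k + 1) := by
  have hjK : (j + 1) * (P.n + 1) ≤ P.K * (P.n + 1) := Nat.mul_le_mul_right _ hj
  rw [add_one_mul] at hjK
  have h3 : s.get 3 = 2 := by rw [hs _ (by norm_num), hc.two]
  have h2 : s.get 2 = 1 := by rw [hs _ (by norm_num), hc.one]
  have h9 : s.get 9 = 2 ^ P.B := by rw [hs _ (by norm_num), hc.modulus]
  have hr : s.get (26 + (j * (P.n + 1) + 1 + k)) = r (j * (P.n + 1) + 1 + k) := by
    rw [hs _ (by omega), hc.random _ (by omega)]
  have hmem := hF.memory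
  have hadr := hF.address
  unfold base at hmem
  have hB : 2 ^ (P.B + 2) < 2 ^ b :=
    (Nat.le_mul_of_pos_right _ hF.pos).trans_lt hF.fine
  have hB' : 2 ^ (P.B + 2) = 4 * 2 ^ P.B := by ring
  have hBpos : 0 < 2 ^ P.B := by positivity
  have hw := hc.words (j * (P.n + 1) + 1 + k) (by omega)
  have hX := s.get_lt 21
  have hbit : i / 2 ^ k % 2 < 2 := Nat.mod_lt _ (by norm_num)
  have hV : r (j * (P.n + 1) + 1 + k) * (i / 2 ^ k % 2) < 2 ^ P.B :=
    lt_of_le_of_lt (mul_le_of_le_one_right (Nat.zero_le _) (by omega)) hw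
  have hACC := fun x => Nat.mod_lt x hBpos
  have hX' : i / 2 ^ k / 2 ≤ i / 2 ^ k := Nat.div_le_self _ _
  rw [h21] at hX
  refine Cmd.Safe.halts ?_ (by simp [bitProg, Cmd.block, Cmd.cost]) ?_
  · simp only [bitProg, Cmd.block, Cmd.Safe, Cmd.eval, WordOp.eval, h20, h21, h22, h23, h2, h3, h9,
      hr, Function.update_apply, Nat.reduceEqDiff, if_true, if_false, and_true, Nat.mod_add_mod]
    have := hACC (r (j * (P.n + 1)) + ∑ k ∈ range k, r (j * (P.n + 1) + 1 + k) * (i / 2 ^ k % 2))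
    have := hACC (r (j * (P.n + 1)) + ∑ k ∈ range k, r (j * (P.n + 1) + 1 + k) *
      (i / 2 ^ k % 2) + r (j * (P.n + 1) + 1 + k) * (i / 2 ^ k % 2))
    refine ⟨?_, ⟨?_, ?_⟩, ⟨?_, ?_⟩, ⟨?_, ?_⟩, ⟨?_, ?_⟩, ⟨?_, ?_⟩, ⟨?_, ?_⟩, ?_, ?_⟩ <;> omega
  · simp only [bitProg, Cmd.block, Cmd.eval, WordOp.eval, h20, h21, h22, h23, h2, h3, h9,
      hr, Function.update_apply, Nat.reduceEqDiff, if_true, if_false, Nat.mod_add_mod]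
    refine ⟨fun a ha => ?_, by omega, by rw [Nat.div_div_eq_div_mul, pow_succ],
      by rw [sum_range_succ, add_assoc], by omega⟩
    rw [if_neg (by omega), if_neg (by omega), if_neg (by omega), if_neg (by omega),
      if_neg (by omega), if_neg (by omega), if_neg (by omega), if_neg (by omega), hs a ha]

theorem hashProg_halts (hF : P.Fits q m b) {i j : ℕ} {s : Memory m b} (hc : P.Config r s.get)
    (hj : j < P.K) (h0 : s.get 0 = i) (h20 : s.get 20 = 26 + j * (P.n + 1)) :
    Halts q hashProg s (10 * P.n + 7) fun g => (∀ a, a < 20 ∨ 26 ≤ a → g a = s.get a) ∧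
      g 20 = 26 + (j + 1) * (P.n + 1) ∧ g 22 = P.word r j i := by
  have hjK : (j + 1) * (P.n + 1) ≤ P.K * (P.n + 1) := Nat.mul_le_mul_right _ hj
  rw [add_one_mul] at hjK
  have hmem := hF.memory
  have hadr := hF.address
  unfold base at hmem
  have hX := s.get_lt 0
  have hV := s.get_lt (26 + j * (P.n + 1))
  have hr : s.get (26 + j * (P.n + 1)) = r (j * (P.n + 1)) := hc.random _ (by omega)
  rw [hr] at hV
  have hV' : r (j * (P.n + 1)) % 2 ^ P.B ≤ r (j * (P.n + 1)) := Nat.mod_le _ _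
  rw [h0] at hX
  -- The counter `c` runs down, so `P.n - c` digits have been processed. The last clause keeps the
  -- unsimplified double subtraction to match `bitProg_halts`.
  let I : ℕ → (ℕ → ℕ) → Prop := fun c g => c ≤ P.n ∧ (∀ a, a < 20 ∨ 26 ≤ a → g a = s.get a) ∧
    g 20 = 26 + (j * (P.n + 1) + 1 + (P.n - c)) ∧ g 21 = i / 2 ^ (P.n - c) ∧
      g 22 = (r (j * (P.n + 1)) +
        ∑ k ∈ range (P.n - c), r (j * (P.n + 1) + 1 + k) * (i / 2 ^ k % 2)) % 2 ^ P.B ∧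
      g 23 = P.n - (P.n - c)
  have hinit : Halts q (.block [.load 22 20, .op .add 21 0 4, .op .mod 22 22 9,
      .op .add 20 20 2, .op .add 23 8 4]) s 6 (I P.n) := by
    refine Cmd.Safe.halts ?_ (by simp [Cmd.block, Cmd.cost]) ?_
    · simp only [Cmd.block, Cmd.Safe, Cmd.eval, WordOp.eval, h0, h20, hr, hc.one, hc.zero,
        hc.modulus, hc.bits, Function.update_apply, Nat.reduceEqDiff, if_true, if_false, and_true]
      refine ⟨?_, ⟨?_, ?_⟩, ⟨?_, ?_⟩, ⟨?_, ?_⟩, ?_, ?_⟩ <;> omega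
    · simp only [I, Cmd.block, Cmd.eval, WordOp.eval, h0, h20, hr, hc.one, hc.zero,
        hc.modulus, hc.bits, Function.update_apply, Nat.reduceEqDiff, if_true, if_false]
      refine ⟨le_rfl, fun a ha => ?_, by omega, by simp, by simp, by omega⟩
      rw [if_neg (by omega), if_neg (by omega), if_neg (by omega), if_neg (by omega),
        if_neg (by omega)]
  have hloop := fun (s₁ : Memory m b) (h : I P.n s₁.get) => Halts.loop (q := q) (p := bitProg)
    (x := 23) (T := 9) I
    (by
      rintro k g ⟨h, -, -, -, -, h'⟩
      omega)
    (by
      rintro c s₂ ⟨h, h₁, h₂, h₃, h₄, h₅⟩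
      obtain ⟨t, s', ht, e, g₁, g₂, g₃, g₄, g₅⟩ :=
        bitProg_halts hF hc hj (P.n - (c + 1)) (by omega) h₁ h₂ h₃ h₄ h₅
      have : P.n - (c + 1) + 1 = P.n - c := by omega
      rw [this] at g₂ g₃ g₄ g₅
      exact ⟨t, s', ht, e, by omega, g₁, g₂, g₃, g₄, g₅⟩) h
  obtain ⟨t, s', ht, e, -, g₁, g₂, g₃, g₄, g₅⟩ := hinit.seq hloop le_rfl
  refine ⟨t, s', by omega, e, g₁, ?_, ?_⟩
  · rw [g₂, add_one_mul]
    omega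
  · rw [g₄]
    rfl

theorem quantileProg_halts (hF : P.Fits q m b) {w : ℕ} {s : Memory m b} (hc : P.Config r s.get)
    (hw : w < 2 ^ P.B) (h22 : s.get 22 = w) :
    Halts q quantileProg s 13 fun g => (∀ a, a < 20 ∨ 26 ≤ a → g a = s.get a) ∧
      g 20 = s.get 20 ∧ g 25 = P.scaled q w := by
  have hmem := hF.memory
  have hadr := hF.address
  have hfine := hF.fine
  have hval := hF.values
  have hnum := hF.num
  have hden := hF.den
  have hlow := hF.low
  have hhigh := hF.high
  have hpos := hF.pos
  unfold base at hmem
  have hBpos : 0 < 2 ^ P.B := by positivity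
  have h1 : 2 ^ (P.B + 2) * P.L = 4 * (2 ^ P.B * P.L) := by ring
  have h2 : (w + w + 1) * P.L ≤ 2 * (2 ^ P.B * P.L) := by
    rw [← mul_assoc]
    exact Nat.mul_le_mul_right _ (by omega)
  have h3 : 2 ^ P.B ≤ 2 ^ P.B * P.L := Nat.le_mul_of_pos_right _ hpos
  have h4 : P.L ≤ 2 ^ P.B * P.L := Nat.le_mul_of_pos_left _ hBpos
  have h5 : w + w + 1 ≤ (w + w + 1) * P.L := Nat.le_mul_of_pos_right _ hpos
  have h6 : ((w + w + 1) * P.L + 2 ^ P.B) / 2 ^ (P.B + 1) ≤ (w + w + 1) * P.L + 2 ^ P.B :=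
    Nat.div_le_self _ _
  -- The program clamps without branching: with truncated subtraction, lo + (G - lo) is a maximum
  -- and x - (x - hi) is a minimum.
  have hmm : ∀ G, P.lo + (G - P.lo) - (P.lo + (G - P.lo) - P.hi) = min (max G P.lo) P.hi := by
    intro G
    omega
  have hix : min (max (((w + w + 1) * P.L + 2 ^ P.B) / 2 ^ (P.B + 1)) P.lo) P.hi = P.index w := by
    rw [index, two_mul]
  have hsc := scaled_le hF w
  have hL2 : P.L ^ 2 ≤ P.L ^ 5 := Nat.pow_le_pow_right hpos (by norm_num)
  have hLd : P.L / (q (P.index w)).den ≤ P.L := Nat.div_le_self _ _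
  have hN := hnum (P.index w)
  have hD := hden (P.index w)
  unfold scaled at hsc
  refine Cmd.Safe.halts ?_ (by simp [quantileProg, Cmd.block, Cmd.cost]) ?_
  · simp only [quantileProg, Cmd.block, Cmd.Safe, Cmd.eval, WordOp.eval, h22, hc.one, hc.low,
      hc.high, hc.grid, hc.modulus, hc.double, Function.update_apply, Nat.reduceEqDiff, if_true,
      if_false, and_true, hmm, hix]
    refine ⟨⟨?_, ?_⟩, ⟨?_, ?_⟩, ⟨?_, ?_⟩, ⟨?_, ?_⟩, ⟨?_, ?_⟩, ⟨?_, ?_⟩, ⟨?_, ?_⟩, ⟨?_, ?_⟩,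
      ⟨?_, ?_⟩, ⟨?_, ?_, ?_, ?_⟩, ⟨?_, ?_⟩, ?_, ?_⟩
    all_goals omega
  · simp only [quantileProg, Cmd.block, Cmd.eval, WordOp.eval, h22, hc.one, hc.low,
      hc.high, hc.grid, hc.modulus, hc.double, Function.update_apply, Nat.reduceEqDiff, if_true,
      if_false, hmm, hix]
    refine ⟨fun a ha => ?_, trivial, rfl⟩
    have : a ≠ 21 ∧ a ≠ 22 ∧ a ≠ 23 ∧ a ≠ 24 ∧ a ≠ 25 := by omega
    simp only [this, if_false]

theorem rowProg_halts (hF : P.Fits q m b) {i j : ℕ} {s : Memory m b} (hc : P.Config r s.get)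
    (hj : j < P.K) (h0 : s.get 0 = i) (h20 : s.get 20 = 26 + j * (P.n + 1)) :
    Halts q rowProg s (10 * P.n + 20) fun g => (∀ a, a < 20 ∨ 26 ≤ a → g a = s.get a) ∧
      g 20 = 26 + (j + 1) * (P.n + 1) ∧ g 25 = P.scaled q (P.word r j i) := by
  refine (hashProg_halts hF hc hj h0 h20).seq (T₂ := 13) ?_ (by omega)
  rintro s₁ ⟨g₁, g₂, g₃⟩
  obtain ⟨t, s', ht, e, g₄, g₅, g₆⟩ := quantileProg_halts hF
    (hc.congr (fun a _ _ => g₁ a (by omega)) fun a _ _ => g₁ a (by omega))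
    (Nat.mod_lt _ (by positivity)) g₃
  exact ⟨t, s', ht, e, fun a ha => by rw [g₄ a ha, g₁ a ha], by rw [g₅, g₂], g₆⟩

/-! ### The update and query loops over the rows. -/

/-- Updates the sketch at the address in cell `15`. -/
def updateTail : Cmd := .block
  [.op .mul 25 25 1, .load 17 15, .op .sub 16 25 17, .op .add 17 17 16, .store 15 17,
    .op .add 15 15 2, .op .sub 14 14 2]

/-- The update program. -/
def updateProg : Cmd := .seq (.block [.op .add 20 6 4, .op .add 15 7 4, .op .add 14 5 4])
  (.loop 14 (.seq rowProg updateTail))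

/-- Compares the quotient of the sketch at the address in cell `15` and the scaled Fréchet
variable in cell `25` with the quotient of the cells `17` and `18`. -/
def queryTail : Cmd := .block
  [.load 19 15, .op .mul 16 19 18, .op .mul 24 17 25, .op .lt 16 16 24,
    .ite 16 (.block [.op .add 17 19 4, .op .add 18 25 4]) .skip,
    .op .add 15 15 2, .op .sub 14 14 2]

/-- The query program. -/
def queryProg : Cmd := .seq (.block [.op .add 20 6 4, .op .add 15 7 4, .op .add 14 5 4,
    .op .add 17 2 4, .op .add 18 4 4])
  (.seq (.loop 14 (.seq rowProg queryTail))
    (.ite 18 (.block [.op .add 0 17 4, .op .add 1 18 4]) (.block [.op .add 0 4 4, .op .add 1 2 4])))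

theorem updateProg_halts (hF : P.Fits q m b) {i a : ℕ} {e : ℕ → ℕ} {s : Memory m b}
    (hc : P.Config r s.get) (h0 : s.get 0 = i) (h1 : s.get 1 = a) (ha : a ≤ P.L)
    (he : ∀ j < P.K, s.get (P.base + j) = e j) (hle : ∀ j < P.K, e j ≤ P.L ^ 3) :
    Halts q updateProg s (P.K * (10 * P.n + 29) + 5) fun g => P.Config r g ∧
      ∀ j < P.K, g (P.base + j) = max (e j) (P.scaled q (P.word r j i) * a) := by
  have hmem := hF.memory
  have hadr := hF.address
  have hbase : 26 ≤ P.base := by unfold base; omega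
  let z : ℕ → ℕ := fun j => P.scaled q (P.word r j i)
  -- With `c` rows left, exactly the first `P.K - c` sketches have been updated.
  let I : ℕ → (ℕ → ℕ) → Prop := fun c g => c ≤ P.K ∧ P.Config r g ∧ g 0 = i ∧ g 1 = a ∧
    g 20 = 26 + (P.K - c) * (P.n + 1) ∧ g 15 = P.base + (P.K - c) ∧ g 14 = c ∧
    ∀ j < P.K, g (P.base + j) = if j < P.K - c then max (e j) (z j * a) else e j
  have hinit : Halts q (.block [.op .add 20 6 4, .op .add 15 7 4, .op .add 14 5 4]) s 4
      (I P.K) := by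
    refine Cmd.Safe.halts ?_ (by simp [Cmd.block, Cmd.cost]) ?_
    · simp only [Cmd.block, Cmd.Safe, Cmd.eval, WordOp.eval, hc.start, hc.zero,
        hc.sketches, hc.rows, Function.update_apply, Nat.reduceEqDiff, if_false, and_true]
      omega
    · simp only [I, Cmd.block, Cmd.eval, WordOp.eval, hc.start, hc.zero,
        hc.sketches, hc.rows, Function.update_apply, Nat.reduceEqDiff, if_true, if_false]
      refine ⟨le_rfl, hc.congr (fun x _ _ => ?_) (fun x _ _ => ?_), h0, h1, by simp, by simp,
        rfl, fun j hj => ?_⟩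
      · have : x ≠ 14 ∧ x ≠ 15 ∧ x ≠ 20 := by omega
        simp only [this, if_false, Function.update_apply]
      · have : x ≠ 14 ∧ x ≠ 15 ∧ x ≠ 20 := by omega
        simp only [this, if_false, Function.update_apply]
      · rw [if_neg (by omega), if_neg (by omega), if_neg (by omega), if_neg (by omega), he j hj]
  have hstep : ∀ c (s₁ : Memory m b), I (c + 1) s₁.get →
      Halts q (.seq rowProg updateTail) s₁ (10 * P.n + 28) (I c) := by
    rintro c s₁ ⟨hcK, hc₁, k₀, k₁, k₂₀, k₁₅, k₁₄, hs⟩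
    obtain ⟨t, ht⟩ : ∃ t, t = P.K - (c + 1) := ⟨_, rfl⟩
    have ht' : P.K - c = t + 1 := by omega
    rw [← ht] at k₂₀ k₁₅ hs
    refine (rowProg_halts hF hc₁ (by omega) k₀ k₂₀).seq (T₂ := 8) ?_ (by omega)
    rintro s₂ ⟨g₁, g₂, g₃⟩
    have hsc := scaled_le hF (P.word r t i)
    change _ = z t at g₃
    change z t ≤ _ at hsc
    have hc₂ := hc₁.congr (fun x _ _ => g₁ x (by omega)) (fun x _ _ => g₁ x (by omega))
    have l₀ : s₂.get 0 = i := by rw [g₁ _ (by omega), k₀]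
    have l₁ : s₂.get 1 = a := by rw [g₁ _ (by omega), k₁]
    have l₁₅ : s₂.get 15 = P.base + t := by rw [g₁ _ (by omega), k₁₅]
    have l₁₄ : s₂.get 14 = c + 1 := by rw [g₁ _ (by omega), k₁₄]
    have lt : s₂.get (P.base + t) = e t := by
      rw [g₁ _ (by omega), hs t (by omega), if_neg (by omega)]
    -- The sketch cell lies beyond all working cells; as equalities with `False` these facts let
    -- `simp` resolve the updates at the symbolic address.
    have n₁ : (P.base + t = 25) = False := eq_false (by omega)
    have n₂ : (14 = P.base + t) = False := eq_false (by omega)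
    have n₃ : (15 = P.base + t) = False := eq_false (by omega)
    have n₄ : (2 = P.base + t) = False := eq_false (by omega)
    have n₅ : (0 = P.base + t) = False := eq_false (by omega)
    have n₆ : (1 = P.base + t) = False := eq_false (by omega)
    have n₇ : (20 = P.base + t) = False := eq_false (by omega)
    -- Again a branch-free maximum through truncated subtraction.
    have hmax : e t + (z t * a - e t) = max (e t) (z t * a) := by omega
    have hza : z t * a ≤ P.L ^ 3 := by
      calc z t * a ≤ P.L ^ 2 * P.L := Nat.mul_le_mul hsc ha
        _ = P.L ^ 3 := by ring
    have hL : P.L ^ 3 ≤ P.L ^ 5 := Nat.pow_le_pow_right hF.pos (by norm_num)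
    have hval := hF.values
    have hle' := hle t (by omega)
    refine Cmd.Safe.halts ?_ (by simp [updateTail, Cmd.block, Cmd.cost]) ?_
    · simp only [updateTail, Cmd.block, Cmd.Safe, Cmd.eval, WordOp.eval, l₁, l₁₅, l₁₄, lt, g₃,
        hc₂.one, Function.update_apply, Nat.reduceEqDiff, if_true, if_false, and_true, n₁, n₂, n₃,
        n₄, hmax]
      omega
    · simp only [I, updateTail, Cmd.block, Cmd.eval, WordOp.eval, l₀, l₁, l₁₅, l₁₄, lt, g₂, g₃,
        hc₂.one, Function.update_apply, Nat.reduceEqDiff, if_true, if_false, n₁, n₂, n₃,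
        n₄, n₅, n₆, n₇, hmax]
      refine ⟨by omega, hc₂.congr (fun x _ _ => ?_) (fun x _ _ => ?_), trivial, trivial,
        by rw [ht'], by omega, by omega, fun j hj => ?_⟩
      · have : x ≠ 14 ∧ x ≠ 15 ∧ x ≠ 16 ∧ x ≠ 17 ∧ x ≠ 25 ∧ x ≠ P.base + t := by omega
        simp only [this, if_false, Function.update_apply]
      · have : x ≠ 14 ∧ x ≠ 15 ∧ x ≠ 16 ∧ x ≠ 17 ∧ x ≠ 25 ∧ x ≠ P.base + t := by omega
        simp only [this, if_false, Function.update_apply]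
      · have : P.base + j ≠ 14 ∧ P.base + j ≠ 15 ∧ P.base + j ≠ 16 ∧ P.base + j ≠ 17 ∧
          P.base + j ≠ 25 := by omega
        simp only [this, if_false, g₁ (P.base + j) (by omega), hs j hj, add_right_inj, ht']
        by_cases hjt : j = t
        · subst hjt
          simp
        · have : j < t + 1 ↔ j < t := by omega
          simp only [hjt, if_false, this]
  obtain ⟨t, s', ht, ex, -, hc', -, -, -, -, -, hs'⟩ := hinit.seq
    (fun s₁ (h : I P.K s₁.get) => Halts.loop I (fun _ _ h => h.2.2.2.2.2.2.1) hstep h) le_rfl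
  refine ⟨t, s', by rw [show 10 * P.n + 29 = 10 * P.n + 28 + 1 from rfl]; omega, ex, hc',
    fun j hj => ?_⟩
  rw [hs' j hj, if_pos (by omega)]

/-- `x / y` is the smallest of the quotients `e j / z j` with `j < t` and `z j ≠ 0`, and
`1 / 0` if there is none. -/
def IsBest (e z : ℕ → ℕ) (t x y : ℕ) : Prop :=
  (y = 0 ∧ x = 1 ∧ ∀ j < t, z j = 0) ∨
    (y ≠ 0 ∧ (∃ j < t, x = e j ∧ y = z j) ∧ ∀ j < t, z j ≠ 0 → x * z j ≤ e j * y)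

/-- Strictness forces `z t ≠ 0`, so a row with zero variable is never selected. From the initial
1/0, which acts as infinity, the first usable row always wins; later, transitivity of the quotient
order follows by cancelling `y`. -/
theorem IsBest.step_lt {e z : ℕ → ℕ} {t x y : ℕ} (h : IsBest e z t x y)
    (hlt : e t * y < x * z t) : IsBest e z (t + 1) (e t) (z t) := by
  have hz : z t ≠ 0 := by
    intro h0
    simp [h0] at hlt
  refine Or.inr ⟨hz, ⟨t, by omega, rfl, rfl⟩, fun j hj hj0 => ?_⟩
  rcases Nat.lt_succ_iff_lt_or_eq.1 hj with hj | rfl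
  · rcases h with ⟨-, -, h⟩ | ⟨hy, -, h⟩
    · exact absurd (h j hj) hj0
    · have h1 := h j hj hj0
      have hy' : 0 < y := by omega
      refine le_of_mul_le_mul_right ?_ hy'
      nlinarith [Nat.mul_le_mul_right (z j) hlt.le, Nat.mul_le_mul_right (z t) h1]
  · exact le_rfl

theorem IsBest.step_not_lt {e z : ℕ → ℕ} {t x y : ℕ} (h : IsBest e z t x y)
    (hlt : ¬e t * y < x * z t) : IsBest e z (t + 1) x y := by
  rcases h with ⟨hy, hx, h⟩ | ⟨hy, ⟨j, hj, h'⟩, h⟩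
  · refine Or.inl ⟨hy, hx, fun j hj => ?_⟩
    rcases Nat.lt_succ_iff_lt_or_eq.1 hj with hj | rfl
    · exact h j hj
    -- Against 1/0 the failed comparison reads `¬ 0 < z t`.
    · rw [hy, hx] at hlt
      omega
  · refine Or.inr ⟨hy, ⟨j, by omega, h'⟩, fun k hk hk0 => ?_⟩
    rcases Nat.lt_succ_iff_lt_or_eq.1 hk with hk | rfl
    · exact h k hk hk0
    · exact not_lt.1 hlt

theorem IsBest.bounds {e z : ℕ → ℕ} {t x y A B : ℕ} (h : IsBest e z t x y)
    (he : ∀ j < t, e j ≤ A) (hz : ∀ j, z j ≤ B) (hA : 1 ≤ A) : x ≤ A ∧ y ≤ B := by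
  rcases h with ⟨rfl, rfl, -⟩ | ⟨-, ⟨j, hj, rfl, rfl⟩, -⟩
  · exact ⟨hA, Nat.zero_le _⟩
  · exact ⟨he j hj, hz j⟩

theorem queryTail_halts (hF : P.Fits q m b) {e z : ℕ → ℕ} {t c x y : ℕ} {s : Memory m b}
    (hc : P.Config r s.get) (ht : t < P.K) (h15 : s.get 15 = P.base + t) (h14 : s.get 14 = c + 1)
    (h17 : s.get 17 = x) (h18 : s.get 18 = y) (h25 : s.get 25 = z t)
    (he : s.get (P.base + t) = e t) (hle : ∀ j < P.K, e j ≤ P.L ^ 3) (hz : ∀ j, z j ≤ P.L ^ 2)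
    (hxy : IsBest e z t x y) :
    Halts q queryTail s 12 fun g => (∀ a, (a < 14 ∨ a = 20 ∨ 26 ≤ a) → g a = s.get a) ∧
      g 15 = P.base + (t + 1) ∧ g 14 = c ∧ IsBest e z (t + 1) (g 17) (g 18) := by
  have hmem := hF.memory
  have hadr := hF.address
  have hval := hF.values
  have hL : ∀ k ≤ 5, P.L ^ k ≤ P.L ^ 5 := fun k hk => Nat.pow_le_pow_right hF.pos hk
  have hbase : 26 ≤ P.base := by unfold base; omega
  obtain ⟨hx, hy⟩ := hxy.bounds (fun j hj => hle j (by omega)) hz (Nat.pow_pos hF.pos)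
  have hlet := hle t ht
  have hzt := hz t
  have hey : e t * y ≤ P.L ^ 5 := by
    calc e t * y ≤ P.L ^ 3 * P.L ^ 2 := Nat.mul_le_mul hlet hy
      _ = P.L ^ 5 := by ring
  have hxz : x * z t ≤ P.L ^ 5 := by
    calc x * z t ≤ P.L ^ 3 * P.L ^ 2 := Nat.mul_le_mul hx hzt
      _ = P.L ^ 5 := by ring
  have hc14 := s.get_lt 14
  rw [h14] at hc14
  have h2 := hL 2 (by norm_num)
  have h3 := hL 3 (by norm_num)
  by_cases hlt : e t * y < x * z t
  · refine Cmd.Safe.halts ?_ (by simp [queryTail, Cmd.block, Cmd.cost]) ?_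
    · simp only [queryTail, Cmd.block, Cmd.Safe, Cmd.eval, WordOp.eval, h15, h14, h17, h18, h25,
        he, hlt, hc.zero, hc.one, Function.update_apply, Nat.reduceEqDiff, if_true, if_false,
        and_true, ne_eq, one_ne_zero, not_false_eq_true, forall_const, false_implies, add_zero]
      omega
    · simp only [queryTail, Cmd.block, Cmd.eval, WordOp.eval, h15, h14, h17, h18, h25,
        he, hlt, hc.zero, hc.one, Function.update_apply, Nat.reduceEqDiff, if_true, if_false,
        one_ne_zero, add_zero]
      refine ⟨fun a ha => ?_, by omega, by omega, hxy.step_lt hlt⟩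
      have : a ≠ 14 ∧ a ≠ 15 ∧ a ≠ 16 ∧ a ≠ 17 ∧ a ≠ 18 ∧ a ≠ 19 ∧ a ≠ 24 := by omega
      simp only [this, if_false]
  · refine Cmd.Safe.halts ?_ (by simp [queryTail, Cmd.block, Cmd.cost]) ?_
    · simp only [queryTail, Cmd.block, Cmd.Safe, Cmd.eval, WordOp.eval, h15, h14, h17, h18, h25,
        he, hlt, hc.zero, hc.one, Function.update_apply, Nat.reduceEqDiff, if_true, if_false,
        and_true, ne_eq, not_true_eq_false, false_implies, implies_true, true_and, add_zero]
      omega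
    · simp only [queryTail, Cmd.block, Cmd.eval, WordOp.eval, h15, h14, h17, h18, h25,
        he, hlt, hc.zero, hc.one, Function.update_apply, Nat.reduceEqDiff, if_true, if_false,
        add_zero]
      refine ⟨fun a ha => ?_, by omega, by omega, hxy.step_not_lt hlt⟩
      have : a ≠ 14 ∧ a ≠ 15 ∧ a ≠ 16 ∧ a ≠ 17 ∧ a ≠ 18 ∧ a ≠ 19 ∧ a ≠ 24 := by omega
      simp only [this, if_false]

/-- The final branch turns the sentinel 1/0 into 0/1, the value of the point estimate when no row is
usable. Only termination is needed, since the cost bound concerns stream items. -/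
theorem queryProg_halts (hF : P.Fits q m b) {i : ℕ} {e : ℕ → ℕ} {s : Memory m b}
    (hc : P.Config r s.get) (h0 : s.get 0 = i)
    (he : ∀ j < P.K, s.get (P.base + j) = e j) (hle : ∀ j < P.K, e j ≤ P.L ^ 3) :
    ∃ T, Halts q queryProg s T fun g => ∃ x y,
      IsBest e (fun j => P.scaled q (P.word r j i)) P.K x y ∧
        g 0 = (if y = 0 then 0 else x) ∧ g 1 = if y = 0 then 1 else y := by
  have hmem := hF.memory
  have hadr := hF.address
  have hbase : 26 ≤ P.base := by unfold base; omega
  obtain ⟨z, hz⟩ : ∃ z, z = fun j => P.scaled q (P.word r j i) := ⟨_, rfl⟩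
  rw [← hz]
  have hzle : ∀ j, z j ≤ P.L ^ 2 := fun j => hz ▸ scaled_le hF _
  let I : ℕ → (ℕ → ℕ) → Prop := fun c g => c ≤ P.K ∧ P.Config r g ∧ g 0 = i ∧
    g 20 = 26 + (P.K - c) * (P.n + 1) ∧ g 15 = P.base + (P.K - c) ∧ g 14 = c ∧
    (∀ j < P.K, g (P.base + j) = e j) ∧ IsBest e z (P.K - c) (g 17) (g 18)
  have hinit : Halts q (.block [.op .add 20 6 4, .op .add 15 7 4, .op .add 14 5 4,
      .op .add 17 2 4, .op .add 18 4 4]) s 6 (I P.K) := by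
    refine Cmd.Safe.halts ?_ (by simp [Cmd.block, Cmd.cost]) ?_
    · simp only [Cmd.block, Cmd.Safe, Cmd.eval, WordOp.eval, hc.start, hc.zero, hc.one,
        hc.sketches, hc.rows, Function.update_apply, Nat.reduceEqDiff, if_false, and_true]
      omega
    · simp only [I, Cmd.block, Cmd.eval, WordOp.eval, hc.start, hc.zero, hc.one,
        hc.sketches, hc.rows, Function.update_apply, Nat.reduceEqDiff, if_true, if_false]
      refine ⟨le_rfl, hc.congr (fun x _ _ => ?_) (fun x _ _ => ?_), h0, by simp, by simp,
        rfl, fun j hj => ?_, Or.inl ⟨rfl, rfl, fun j hj => by omega⟩⟩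
      · have : x ≠ 14 ∧ x ≠ 15 ∧ x ≠ 17 ∧ x ≠ 18 ∧ x ≠ 20 := by omega
        simp only [this, if_false, Function.update_apply]
      · have : x ≠ 14 ∧ x ≠ 15 ∧ x ≠ 17 ∧ x ≠ 18 ∧ x ≠ 20 := by omega
        simp only [this, if_false, Function.update_apply]
      · have : P.base + j ≠ 14 ∧ P.base + j ≠ 15 ∧ P.base + j ≠ 17 ∧ P.base + j ≠ 18 ∧
          P.base + j ≠ 20 := by omega
        simp only [this, if_false, he j hj]
  have hstep : ∀ c (s₁ : Memory m b), I (c + 1) s₁.get →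
      Halts q (.seq rowProg queryTail) s₁ (10 * P.n + 32) (I c) := by
    rintro c s₁ ⟨hcK, hc₁, k₀, k₂₀, k₁₅, k₁₄, hs, hbest⟩
    obtain ⟨t, ht⟩ : ∃ t, t = P.K - (c + 1) := ⟨_, rfl⟩
    have ht' : P.K - c = t + 1 := by omega
    rw [← ht] at k₂₀ k₁₅ hbest
    refine (rowProg_halts hF hc₁ (by omega) k₀ k₂₀).seq (T₂ := 12) ?_ (by omega)
    rintro s₂ ⟨g₁, g₂, g₃⟩
    have hc₂ := hc₁.congr (fun x _ _ => g₁ x (by omega)) (fun x _ _ => g₁ x (by omega))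
    obtain ⟨T, s₃, hT, ex, w₁, w₂, w₃, w₄⟩ := queryTail_halts (e := e) (z := z) (t := t) (c := c)
      hF hc₂ (by omega) (by rw [g₁ _ (by omega), k₁₅]) (by rw [g₁ _ (by omega), k₁₄])
      (g₁ 17 (by omega)) (g₁ 18 (by omega)) (by rw [g₃, hz])
      (by rw [g₁ _ (by omega), hs t (by omega)]) hle hzle hbest
    refine ⟨T, s₃, hT, ex, by omega, hc₂.congr (fun x _ _ => w₁ x (by omega))
      (fun x _ _ => w₁ x (by omega)), ?_, ?_, ?_, w₃, fun j hj => ?_, ?_⟩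
    · rw [w₁ _ (by omega), g₁ _ (by omega), k₀]
    · rw [w₁ _ (by omega), g₂, ht']
    · rw [w₂, ht']
    · rw [w₁ _ (by omega), g₁ _ (by omega), hs j hj]
    · rw [ht']
      exact w₄
  refine ⟨_, hinit.seq (fun s₁ (h : I P.K s₁.get) =>
    (Halts.loop I (fun _ _ h => h.2.2.2.2.2.1) hstep h).seq (T₂ := 7) ?_ le_rfl) le_rfl⟩
  rintro s₂ ⟨-, hc₂, -, -, -, -, -, hbest⟩
  rw [Nat.sub_zero] at hbest
  have h17 := s₂.get_lt 17
  have h18 := s₂.get_lt 18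
  refine Cmd.Safe.halts ?_ (by simp [Cmd.block, Cmd.cost]) ⟨_, _, hbest, ?_⟩
  · simp only [Cmd.block, Cmd.Safe, Cmd.eval, WordOp.eval, hc₂.zero, hc₂.one,
      Function.update_apply, Nat.reduceEqDiff, if_false, and_true]
    omega
  · by_cases h : s₂.get 18 = 0 <;>
    simp [Cmd.block, Cmd.eval, WordOp.eval, hc₂.zero, hc₂.one, h]

end SketchParams

/-! ### The grid -/

theorem zero_mem_ratGrid {L : ℕ} (hL : 0 < L) : (0 : ℚ≥0) ∈ ratGrid L := by
  simp only [ratGrid, ratSet, mem_filter, mem_image, mem_product, mem_range, mem_Icc, Prod.exists,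
    zero_mul, NNRat.den_zero, and_true]
  exact ⟨0, 1, ⟨by omega, by omega⟩, by simp⟩

theorem nearest_mem {S : Finset ℚ≥0} (hS : S.Nonempty) (x : ℝ) : nearest S x ∈ S := by
  rw [nearest, dif_pos hS]
  exact (S.exists_min_image _ hS).choose_spec.1

theorem abs_nearest_sub_le {S : Finset ℚ≥0} (x : ℝ) {s : ℚ≥0} (hs : s ∈ S) :
    |(nearest S x : ℝ) - x| ≤ |(s : ℝ) - x| := by
  rw [nearest, dif_pos ⟨s, hs⟩]
  exact (S.exists_min_image (fun s => |(s : ℝ) - x|) ⟨s, hs⟩).choose_spec.2 s hs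

theorem discQuantile_mem {L : ℕ} (hL : 0 < L) (α : ℝ) (k : ℕ) :
    discQuantile α L k ∈ ratGrid L := nearest_mem ⟨0, zero_mem_ratGrid hL⟩ _

/-- The reduced numerator divides the numerator p ≤ L of the representation p/q; p = 0 is separate
because divisibility then gives no bound. -/
theorem num_le_of_mem_ratGrid {L : ℕ} {x : ℚ≥0} (hx : x ∈ ratGrid L) : x.num ≤ L := by
  simp only [ratGrid, ratSet, mem_filter, mem_image, mem_product, mem_range, mem_Icc,
    Prod.exists] at hx
  obtain ⟨⟨p, q, ⟨hp, hq, -⟩, rfl⟩, -⟩ := hx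
  rcases Nat.eq_zero_or_pos p with rfl | hp0
  · simp
  have h : ((p / q : ℚ≥0).num : ℚ≥0) * q = p * (p / q : ℚ≥0).den := by
    have hq' : (q : ℚ≥0) ≠ 0 := by
      rw [Nat.cast_ne_zero]
      omega
    rw [← NNRat.mul_den_eq_num, mul_right_comm, div_mul_cancel₀ _ hq']
  have h' : (p / q : ℚ≥0).num * q = p * (p / q : ℚ≥0).den := by exact_mod_cast h
  have := (NNRat.coprime_num_den (p / q : ℚ≥0)).dvd_of_dvd_mul_right
    (Dvd.intro _ h')
  have := Nat.le_of_dvd hp0 this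
  omega

/-- Since x L is an integer, den divides num · L, and it is coprime to num. Hence the machine's
integer division of L by the denominator is exact. -/
theorem den_dvd_of_mem_ratGrid {L : ℕ} {x : ℚ≥0} (hx : x ∈ ratGrid L) : x.den ∣ L := by
  have h := (mem_filter.1 hx).2
  have h1 : (x.num : ℚ≥0) * L = (x * L).num * x.den := by
    rw [← NNRat.mul_den_eq_num, ← NNRat.mul_den_eq_num (x * L), h]
    push_cast
    ring
  have h2 : x.num * L = (x * L).num * x.den := by exact_mod_cast h1
  exact (NNRat.coprime_num_den x).symm.dvd_of_dvd_mul_left (Dvd.intro_left _ h2.symm)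

theorem scaled_eq_of_mem_ratGrid {L : ℕ} {x : ℚ≥0} (hx : x ∈ ratGrid L) :
    ((x.num * (L / x.den) : ℕ) : ℚ≥0) = x * L := by
  have hd : (x.den : ℚ≥0) ≠ 0 := by simp
  rw [Nat.cast_mul, Nat.cast_div (den_dvd_of_mem_ratGrid hx) hd, ← NNRat.mul_den_eq_num]
  field_simp

theorem le_of_mem_ratGrid {L : ℕ} {x : ℚ≥0} (hx : x ∈ ratGrid L) : x ≤ L := by
  rw [← NNRat.num_div_den x]
  refine (div_le_self (by simp) ?_).trans (Nat.cast_le.2 (num_le_of_mem_ratGrid hx))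
  exact Nat.one_le_cast.2 x.den_pos

/-! ### The programs implement the point estimator -/

theorem foldl_max_le {ι : Type*} (g : ι → ℕ) (S : List ι) (e c : ℕ) :
    S.foldl (fun x p => max x (g p)) e ≤ c ↔ e ≤ c ∧ ∀ p ∈ S, g p ≤ c := by
  induction S generalizing e with
  | nil => simp
  | cons p S ih => simp [ih, and_assoc]

/-- Both sides have the same upper bounds: each item is dominated by the final signal, and each
nonzero value of the signal occurs as an item. -/
theorem foldl_max_eq_sup {N : ℕ} {S : List (Fin N × ℕ)} {f : Fin N → ℕ} (hS : IsStreamOf S f)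
    (z : Fin N → ℕ) :
    S.foldl (fun x p => max x (z p.1 * p.2)) 0 = univ.sup fun i => f i * z i := by
  refine eq_of_forall_ge_iff fun c => ?_
  rw [foldl_max_le, Finset.sup_le_iff]
  constructor
  · rintro ⟨-, h⟩ i -
    rcases (hS i).2 with hi | ⟨-, hi⟩
    · exact (mul_comm _ _).trans_le (h _ hi)
    · simp [hi]
  · refine fun h => ⟨Nat.zero_le _, fun p hp => ?_⟩
    refine le_trans ?_ (h p.1 (mem_univ _))
    rw [mul_comm]
    exact Nat.mul_le_mul_right _ ((hS p.1).1 p.2 hp)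

theorem cast_sup_eq_sketch_mul {N K : ℕ} (f : Fin N → ℕ) (Z : Fin K → Fin N → ℚ≥0) (j : Fin K)
    (z : Fin N → ℕ) {l : ℚ≥0} (hz : ∀ i, (z i : ℚ≥0) = Z j i * l) :
    ((univ.sup fun i => f i * z i : ℕ) : ℚ≥0) = sketch f Z j * l := by
  have h1 : ((univ.sup fun i => f i * z i : ℕ) : ℚ≥0) =
      univ.sup (((↑) : ℕ → ℚ≥0) ∘ fun i => f i * z i) :=
    Finset.apply_sup_eq_sup_comp _ (fun a b => Nat.cast_max a b) (by simp)
  have h2 : sketch f Z j * l = univ.sup ((fun x => x * l) ∘ fun i => (f i : ℚ≥0) * Z j i) :=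
    Finset.apply_sup_eq_sup_comp (fun x => x * l)
      (fun a b => max_mul_of_nonneg a b (zero_le (a := l))) (by simp)
  rw [h1, h2]
  congr 1
  funext i
  simp [hz, mul_assoc]

namespace SketchParams

/-- The scale `l` is common to sketches and variables, so it cancels in every quotient. -/
theorem pointEstimate_eq_of_isBest {N K : ℕ} {f : Fin N → ℕ} {Z : Fin K → Fin N → ℚ≥0}
    {i₀ : Fin N} {e z : ℕ → ℕ} {l : ℚ≥0} (hl : l ≠ 0)
    (he : ∀ j : Fin K, (e j : ℚ≥0) = sketch f Z j * l)
    (hz : ∀ j : Fin K, (z j : ℚ≥0) = Z j i₀ * l) {x y : ℕ} (h : IsBest e z K x y) :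
    pointEstimate f Z i₀ =
      ((if y = 0 then 0 else x : ℕ) : ℚ≥0) / ((if y = 0 then 1 else y : ℕ) : ℚ≥0) := by
  have hz0 : ∀ j : Fin K, z j = 0 ↔ Z j i₀ = 0 := fun j => by
    rw [← Nat.cast_eq_zero (R := ℚ≥0), hz]
    simp [hl]
  unfold pointEstimate
  rcases h with ⟨rfl, rfl, h⟩ | ⟨hy, ⟨j, hj, rfl, rfl⟩, h⟩
  · rw [dif_neg]
    · simp
    · rintro ⟨j, hj⟩
      exact (mem_filter.1 hj).2 ((hz0 j).1 (h j j.2))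
  · have hjm : (⟨j, hj⟩ : Fin K) ∈ univ.filter fun j => Z j i₀ ≠ 0 := by
      simp only [mem_filter, mem_univ, true_and, ne_eq]
      rw [← hz0]
      exact hy
    have hq : ∀ k : Fin K, sketch f Z k / Z k i₀ = (e k : ℚ≥0) / (z k : ℚ≥0) := fun k => by
      rw [he, hz, mul_div_mul_right _ _ hl]
    rw [dif_pos ⟨_, hjm⟩, if_neg hy, if_neg hy]
    refine le_antisymm ?_ ?_
    · exact (Finset.inf'_le _ hjm).trans_eq (hq ⟨j, hj⟩)
    · refine Finset.le_inf' _ _ fun k hk => ?_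
      have hk0 : z k ≠ 0 := fun h0 => (mem_filter.1 hk).2 ((hz0 k).1 h0)
      rw [hq k, div_le_div_iff₀ (Nat.cast_pos.2 (Nat.pos_of_ne_zero hy))
        (Nat.cast_pos.2 (Nat.pos_of_ne_zero hk0))]
      exact_mod_cast h k k.2 hk0

/-- The parameters as they are stored in the memory. -/
def header (P : SketchParams) (b : ℕ) (x : Fin 24) : Fin (2 ^ b) :=
  Fin.ofNat (2 ^ b) ([1, 2, 0, P.K, 26, P.base, P.n, 2 ^ P.B, 2 ^ (P.B + 1), P.L, P.lo,
    P.hi].getD x 0)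

variable {P : SketchParams} {q : ℕ → ℚ≥0} {m b : ℕ}

/-- The word with number `k` of the vector `ω`. -/
def randomWord {R B : ℕ} (ω : Fin R → Fin (2 ^ B)) (k : ℕ) : ℕ :=
  if h : k < R then ω ⟨k, h⟩ else 0

theorem randomWord_lt {R B : ℕ} (ω : Fin R → Fin (2 ^ B)) (k : ℕ) : randomWord ω k < 2 ^ B := by
  unfold randomWord
  split_ifs
  · exact Fin.isLt _
  · positivity

theorem config_startMemory (hF : P.Fits q m b) (ω : Fin (P.K * (P.n + 1)) → Fin (2 ^ P.B)) :
    P.Config (randomWord ω) (startMemory (m := m) (P.header b) ω).get ∧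
      ∀ j < P.K, (startMemory (m := m) (P.header b) ω).get (P.base + j) = 0 := by
  have hmem := hF.memory
  have hadr := hF.address
  have hval := hF.values
  have hlow := hF.low
  have hhigh := hF.high
  have hL5 : P.L ≤ P.L ^ 5 := Nat.le_self_pow (by norm_num) _
  have hB : 2 ^ (P.B + 2) < 2 ^ b :=
    (Nat.le_mul_of_pos_right _ hF.pos).trans_lt hF.fine
  have hB1 : 2 ^ (P.B + 2) = 4 * 2 ^ P.B := by ring
  have hB2 : 2 ^ (P.B + 1) = 2 * 2 ^ P.B := by ring
  unfold base at hmem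
  have hn : P.n + 1 ≤ P.K * (P.n + 1) := Nat.le_mul_of_pos_left _ hF.rows
  have hhead : ∀ x (hx : x < 24), (startMemory (m := m) (P.header b) ω).get (2 + x) =
      ([1, 2, 0, P.K, 26, P.base, P.n, 2 ^ P.B, 2 ^ (P.B + 1), P.L, P.lo,
        P.hi].getD x 0) % 2 ^ b := by
    intro x hx
    have h1 : 2 + x < m := by omega
    have h2 : ¬2 + x < 2 := by omega
    have h3 : 2 + x - 2 < 24 := by omega
    rw [Memory.get, dif_pos h1, startMemory, if_neg h2, dif_pos h3]
    simp [header]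
  refine ⟨⟨(hhead 0 ?_).trans ?_, (hhead 1 ?_).trans ?_, (hhead 2 ?_).trans ?_,
    (hhead 3 ?_).trans ?_, (hhead 4 ?_).trans ?_, (hhead 5 ?_).trans ?_, (hhead 6 ?_).trans ?_,
    (hhead 7 ?_).trans ?_, (hhead 8 ?_).trans ?_, (hhead 9 ?_).trans ?_, (hhead 10 ?_).trans ?_,
    (hhead 11 ?_).trans ?_, fun k hk => ?_, fun k hk => randomWord_lt ω k⟩, fun j hj => ?_⟩
  any_goals norm_num; done
  any_goals
    refine Nat.mod_eq_of_lt ?_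
    simp only [List.getD_cons_succ, List.getD_cons_zero, base]
    omega
  · have h1 : 26 + k < m := by omega
    have h2 : ¬26 + k < 2 := by omega
    have h3 : ¬26 + k - 2 < 24 := by omega
    have h4 : 26 + k - 2 - 24 < P.K * (P.n + 1) := by omega
    have h5 : 26 + k - 2 - 24 = k := by omega
    rw [Memory.get, dif_pos h1, startMemory, if_neg h2, dif_neg h3, dif_pos h4, randomWord,
      dif_pos hk, Fin.val_ofNat, Nat.mod_eq_of_lt (by omega)]
    simp only [h5]
  · have h1 : 26 + P.K * (P.n + 1) + j < m := by omega
    have h2 : ¬26 + P.K * (P.n + 1) + j < 2 := by omega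
    have h3 : ¬26 + P.K * (P.n + 1) + j - 2 < 24 := by omega
    have h4 : ¬26 + P.K * (P.n + 1) + j - 2 - 24 < P.K * (P.n + 1) := by omega
    rw [base, Memory.get, dif_pos h1, startMemory, if_neg h2, dif_neg h3, dif_neg h4]
    rfl

/-- The bound L³ on the sketches is carried through the induction: a new candidate is at most L²
times an item value at most L. -/
theorem exists_readsStream (hF : P.Fits q m b) {N : ℕ} (hN : N ≤ 2 ^ b) {r : ℕ → ℕ}
    (S : List (Fin N × ℕ)) (hS : ∀ p ∈ S, p.2 ≤ P.L) (s : Memory m b) (hc : P.Config r s.get)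
    (e : ℕ → ℕ) (he : ∀ j < P.K, s.get (P.base + j) = e j) (hle : ∀ j < P.K, e j ≤ P.L ^ 3) :
    ∃ s', ReadsStream q updateProg (P.K * (10 * P.n + 29) + 5) S s s' ∧ P.Config r s'.get ∧
      ∀ j < P.K, s'.get (P.base + j) =
        S.foldl (fun x p => max x (P.scaled q (P.word r j p.1) * p.2)) (e j) := by
  induction S generalizing s e with
  | nil => exact ⟨s, rfl, hc, he⟩
  | cons p S ih =>
    obtain ⟨i, a⟩ := p
    have ha : a ≤ P.L := hS (i, a) (by simp)
    have hmem := hF.memory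
    have hadr := hF.address
    have hval := hF.values
    have hL5 : P.L ≤ P.L ^ 5 := Nat.le_self_pow (by norm_num) _
    unfold base at hmem
    have hget : ((s.set 0 i).set 1 a).get = Function.update (Function.update s.get 0 i) 1 a := by
      rw [Memory.get_set _ (by omega) (by omega), Memory.get_set _ (by omega) (by omega)]
    have hget' : ∀ x, 2 ≤ x → ((s.set 0 i).set 1 a).get x = s.get x := fun x hx => by
      rw [hget, Function.update_of_ne (by omega), Function.update_of_ne (by omega)]
    obtain ⟨t, s₁, ht, ex, hc₁, he₁⟩ := updateProg_halts hF (i := i) (a := a) (e := e)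
      (hc.congr (fun x _ _ => hget' x (by omega)) fun x _ _ => hget' x (by omega))
      (by simp [hget]) (by simp [hget]) ha
      (fun j hj => by rw [hget' _ (by unfold base; omega), he j hj]) hle
    obtain ⟨s', hs', hc', he'⟩ := ih (fun p hp => hS p (by simp [hp])) s₁ hc₁ _ he₁
      (fun j hj => max_le (hle j hj) (by
        calc _ ≤ P.L ^ 2 * P.L := Nat.mul_le_mul (scaled_le hF _) ha
          _ = P.L ^ 3 := by ring))
    exact ⟨s', ⟨t, s₁, ht, ex, hs'⟩, hc', he'⟩

/-- The pseudorandom word of row `j` and index `i`. -/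
def hashWord (P : SketchParams) {N : ℕ} (ω : Fin (P.K * (P.n + 1)) → Fin (2 ^ P.B))
    (j : Fin P.K) (i : Fin N) : Fin (2 ^ P.B) :=
  ⟨P.word (randomWord ω) j i, Nat.mod_lt _ (by positivity)⟩

/-- Clearing fractions at a midpoint makes real rounding the floor of a quotient of naturals, that
is, one integer division. -/
theorem gridIndex_eq_index {γ : ℝ} (hlo : P.lo = ⌈γ * P.L⌉₊) (hhi : P.hi = ⌊(1 - γ) * P.L⌋₊)
    (w : ℕ) : gridIndex P.L γ (((w : ℝ) + 1 / 2) / 2 ^ P.B) = P.index w := by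
  have h : ((w : ℝ) + 1 / 2) / 2 ^ P.B * P.L + 1 / 2 =
      (((2 * w + 1) * P.L + 2 ^ P.B : ℕ) : ℝ) / ((2 ^ (P.B + 1) : ℕ) : ℝ) := by
    push_cast
    field_simp
    ring
  rw [gridIndex, h, Nat.floor_div_eq_div, ← hlo, ← hhi]
  rfl

theorem scaled_word {α γ : ℝ} (hL : 0 < P.L) (hlo : P.lo = ⌈γ * P.L⌉₊)
    (hhi : P.hi = ⌊(1 - γ) * P.L⌋₊) {N : ℕ} (ω : Fin (P.K * (P.n + 1)) → Fin (2 ^ P.B))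
    (j : Fin P.K) (i : Fin N) :
    (P.scaled (discQuantile α P.L) (P.word (randomWord ω) j i) : ℚ≥0) =
      pseudoFrechet α P.L γ (P.hashWord ω) j i * P.L := by
  rw [scaled, scaled_eq_of_mem_ratGrid (discQuantile_mem hL _ _), pseudoFrechet, discFrechet,
    gridIndex_eq_index hlo hhi]
  rfl

theorem implements {α γ : ℝ} (hF : P.Fits (discQuantile α P.L) m b)
    (hlo : P.lo = ⌈γ * P.L⌉₊) (hhi : P.hi = ⌊(1 - γ) * P.L⌋₊) {N : ℕ} (hN : N ≤ 2 ^ b)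
    (ω : Fin (P.K * (P.n + 1)) → Fin (2 ^ P.B)) {f : Fin N → ℕ} {S : List (Fin N × ℕ)}
    (hf : ∀ i, f i ≤ P.L) (hS : IsStreamOf S f) :
    ∃ s : Memory m b, ReadsStream (discQuantile α P.L) updateProg (P.K * (10 * P.n + 29) + 5) S
        (startMemory (P.header b) ω) s ∧
      ∀ i₀ : Fin N, Answers (discQuantile α P.L) queryProg s i₀
        (pointEstimate f (pseudoFrechet α P.L γ (P.hashWord ω)) i₀) := by
  obtain ⟨hc, h0⟩ := config_startMemory hF ω
  obtain ⟨s, hs, hc', he⟩ := exists_readsStream hF hN S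
    (fun p hp => ((hS p.1).1 p.2 hp).trans (hf _)) _ hc (fun _ => 0) h0 (fun _ _ => Nat.zero_le _)
  refine ⟨s, hs, fun i₀ => ?_⟩
  let z : ℕ → Fin N → ℕ := fun j i => P.scaled (discQuantile α P.L) (P.word (randomWord ω) j i)
  have he' : ∀ j < P.K, s.get (P.base + j) = univ.sup fun i => f i * z j i := fun j hj => by
    rw [he j hj, ← foldl_max_eq_sup hS]
  have hmem := hF.memory
  unfold base at hmem
  have hget : ∀ x, 2 ≤ x → (s.set 0 i₀).get x = s.get x := fun x hx => by
    rw [Memory.get_set _ (by omega) (by omega), Function.update_of_ne (by omega)]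
  obtain ⟨T, t, s', -, ex, x, y, hxy, h₀, h₁⟩ := queryProg_halts hF (i := i₀)
    (s := s.set 0 i₀) (e := fun j => univ.sup fun i => f i * z j i)
    (hc'.congr (fun x _ _ => hget x (by omega)) fun x _ _ => hget x (by omega))
    (by rw [Memory.get_set _ (by omega) (by omega), Function.update_self])
    (fun j hj => by rw [hget _ (by unfold base; omega), he' j hj])
    (fun j hj => Finset.sup_le fun i _ => by
      calc f i * z j i ≤ P.L * P.L ^ 2 := Nat.mul_le_mul (hf i) (scaled_le hF _)
        _ = P.L ^ 3 := by ring)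
  refine ⟨t, s', ex, ?_, ?_⟩
  · rw [h₁]
    split_ifs with h
    · exact one_ne_zero
    · exact h
  · rw [h₀, h₁]
    exact pointEstimate_eq_of_isBest (Nat.cast_ne_zero.2 hF.pos.ne')
      (fun j => cast_sup_eq_sketch_mul f _ j (z j) fun i => scaled_word hF.pos hlo hhi ω j i)
      (fun j => scaled_word hF.pos hlo hhi ω j i₀) hxy

end SketchParams

/-! ### Probabilities under uniform distributions -/

section UnifProb

variable {Ω Ω' : Type}

theorem unifProb_nonneg (p : Ω → Prop) : 0 ≤ unifProb p := by
  unfold unifProb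
  positivity

theorem unifProb_mono [Finite Ω] {p p' : Ω → Prop} (h : ∀ ω, p ω → p' ω) :
    unifProb p ≤ unifProb p' := by
  unfold unifProb
  gcongr
  exact Nat.card_le_card_of_injective (fun ω : {ω // p ω} => (⟨ω, h _ ω.2⟩ : {ω // p' ω}))
    fun a b hab => Subtype.ext (by simpa using hab)

theorem unifProb_or_le (p p' : Ω → Prop) :
    unifProb (fun ω => p ω ∨ p' ω) ≤ unifProb p + unifProb p' := by
  unfold unifProb
  rw [← add_div]
  gcongr
  rw [← Nat.cast_add, Nat.cast_le]
  exact Set.ncard_union_le {ω | p ω} {ω | p' ω}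

theorem unifProb_exists_le [Finite Ω] {ι : Type*} (s : Finset ι) (p : ι → Ω → Prop) :
    unifProb (fun ω => ∃ i ∈ s, p i ω) ≤ ∑ i ∈ s, unifProb (p i) := by
  classical
  induction s using Finset.induction_on with
  | empty => simp [unifProb]
  | insert a s ha ih =>
    rw [sum_insert ha]
    refine le_trans (unifProb_mono fun ω => ?_) ((unifProb_or_le (p a) _).trans
      (add_le_add_right ih _))
    simp

theorem unifProb_add_not [Finite Ω] [Nonempty Ω] (p : Ω → Prop) :
    unifProb p + unifProb (fun ω => ¬p ω) = 1 := by
  unfold unifProb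
  rw [← add_div, div_eq_one_iff_eq (Nat.cast_ne_zero.2 Nat.card_pos.ne')]
  have := Set.ncard_add_ncard_compl {ω | p ω}
  exact_mod_cast this

theorem unifProb_congr_equiv (e : Ω ≃ Ω') (p : Ω' → Prop) :
    unifProb (fun ω => p (e ω)) = unifProb p := by
  unfold unifProb
  rw [Nat.card_congr e, Nat.card_congr (e.subtypeEquiv (p := fun ω => p (e ω)) (q := p)
    fun a => Iff.rfl)]

theorem unifProb_prod (p : Ω → Prop) (p' : Ω' → Prop) :
    unifProb (fun ω : Ω × Ω' => p ω.1 ∧ p' ω.2) = unifProb p * unifProb p' := by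
  unfold unifProb
  rw [Nat.card_congr (Equiv.subtypeProdEquivProd (p := p) (q := p')), Nat.card_prod, Nat.card_prod]
  push_cast
  rw [mul_div_mul_comm]

theorem unifProb_forall {K : ℕ} (p : Ω → Prop) :
    unifProb (fun ω : Fin K → Ω => ∀ j, p (ω j)) = unifProb p ^ K := by
  unfold unifProb
  rw [Nat.card_congr (Equiv.subtypePiEquivPi (p := fun _ : Fin K => p)), Nat.card_pi, Nat.card_pi]
  simp [div_pow]

/-- The fibres are cosets of the kernel and so equally large; a section of `φ` splits the preimage
of an event as the event times the kernel. Applied to one hash this gives uniformity, applied to a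
pair it gives independence. -/
theorem unifProb_comp_addMonoidHom {G H : Type} [AddGroup G] [AddGroup H] [Finite G] [Finite H]
    (φ : G →+ H) (hφ : Function.Surjective φ) (p : H → Prop) :
    unifProb (fun g => p (φ g)) = unifProb p := by
  have key : ∀ p : H → Prop, Nat.card {g // p (φ g)} = Nat.card {h // p h} * Nat.card φ.ker := by
    intro p
    rw [← Nat.card_prod]
    refine Nat.card_congr
      { toFun := fun g => (⟨φ g, g.2⟩, ⟨g - Function.surjInv hφ (φ g), by
          simp [AddMonoidHom.mem_ker, Function.surjInv_eq]⟩)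
        invFun := fun x => ⟨x.2 + Function.surjInv hφ x.1, by
          have : φ x.2 = 0 := x.2.2
          simp only [map_add, this, Function.surjInv_eq, zero_add]
          exact x.1.2⟩
        left_inv := fun g => by simp
        right_inv := fun x => by
          have : φ x.2 = 0 := x.2.2
          ext <;> simp [this, Function.surjInv_eq] }
  have hG : Nat.card G = Nat.card H * Nat.card φ.ker := by
    have := key fun _ => True
    rwa [Nat.card_congr (Equiv.subtypeUnivEquiv fun _ => trivial),
      Nat.card_congr (Equiv.subtypeUnivEquiv fun _ => trivial)] at this
  unfold unifProb
  rw [key, hG]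
  push_cast
  exact mul_div_mul_right _ _ (Nat.cast_ne_zero.2 Nat.card_pos.ne')

end UnifProb

/-! ### The uniform distribution on the midpoints -/

/-- The midpoint of the interval with number `w` in the partition of `[0, 1]` into `2 ^ B`
intervals. -/
def midpt {B : ℕ} (w : Fin (2 ^ B)) : ℝ := (((w : ℕ) : ℝ) + 1 / 2) / 2 ^ B

theorem midpt_pos {B : ℕ} (w : Fin (2 ^ B)) : 0 < midpt w := by
  unfold midpt
  positivity

theorem midpt_rev {B : ℕ} (w : Fin (2 ^ B)) : midpt w.rev = 1 - midpt w := by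
  have h : ((w.rev : ℕ) : ℝ) = 2 ^ B - 1 - w := by
    rw [Fin.val_rev, Nat.cast_sub (by omega)]
    push_cast
    ring
  rw [midpt, midpt, h]
  field_simp
  ring

theorem midpt_lt_one {B : ℕ} (w : Fin (2 ^ B)) : midpt w < 1 := by
  have := midpt_pos w.rev
  rw [midpt_rev] at this
  linarith

theorem unifProb_midpt_lt_le_floor {B : ℕ} (u : ℝ) :
    unifProb (fun w : Fin (2 ^ B) => midpt w < u) ≤ (⌊u * 2 ^ B + 1 / 2⌋₊ : ℝ) / 2 ^ B := by
  unfold unifProb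
  rw [Nat.card_fin, Nat.cast_pow, Nat.cast_ofNat]
  gcongr
  rw [← Nat.card_fin ⌊u * 2 ^ B + 1 / 2⌋₊]
  refine Nat.card_le_card_of_injective (fun w => ⟨(w : Fin (2 ^ B)), ?_⟩) fun a b hab => ?_
  · have h : midpt (w : Fin (2 ^ B)) < u := w.2
    rw [midpt, div_lt_iff₀ (by positivity)] at h
    refine Nat.lt_of_succ_le (Nat.le_floor ?_)
    push_cast
    linarith
  · exact Subtype.ext (Fin.ext (by simpa using hab))

/-- The factor 2 removes any condition on B: if u 2^B < 1/2 there is no midpoint below u, and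
otherwise the rounding term 1/2 is at most u 2^B. -/
theorem unifProb_midpt_lt_le {B : ℕ} {u : ℝ} (hu : 0 ≤ u) :
    unifProb (fun w : Fin (2 ^ B) => midpt w < u) ≤ 2 * u := by
  refine (unifProb_midpt_lt_le_floor u).trans ?_
  rw [div_le_iff₀ (by positivity), mul_assoc]
  have hx : 0 ≤ u * 2 ^ B := by positivity
  rcases lt_or_ge (u * 2 ^ B) (1 / 2) with h | h
  · rw [Nat.floor_eq_zero.2 (by linarith)]
    simpa using hx
  · exact (Nat.floor_le (by linarith)).trans (by linarith)

theorem unifProb_lt_midpt_le {B : ℕ} {u : ℝ} (hu : u ≤ 1) :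
    unifProb (fun w : Fin (2 ^ B) => u < midpt w) ≤ 2 * (1 - u) := by
  rw [← unifProb_congr_equiv Fin.revPerm]
  refine le_trans (unifProb_mono fun w hw => ?_) (unifProb_midpt_lt_le (sub_nonneg.2 hu))
  rw [Fin.revPerm_apply, midpt_rev] at hw
  linarith

/-- A lower bound does need a fine enough grid: the rounding error 1/2 must not exceed half of (1-u)
2^B. -/
theorem le_unifProb_le_midpt {B : ℕ} {u : ℝ} (hu : 0 ≤ u) (h : 1 ≤ (1 - u) * 2 ^ B) :
    (1 - u) / 2 ≤ unifProb (fun w : Fin (2 ^ B) => u ≤ midpt w) := by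
  have h1 := unifProb_add_not fun w : Fin (2 ^ B) => u ≤ midpt w
  simp only [not_le] at h1
  have h2 := unifProb_midpt_lt_le_floor (B := B) u
  have h3 : (⌊u * 2 ^ B + 1 / 2⌋₊ : ℝ) / 2 ^ B ≤ u + (1 - u) / 2 := by
    rw [div_le_iff₀ (by positivity)]
    have := Nat.floor_le (show (0 : ℝ) ≤ u * 2 ^ B + 1 / 2 by positivity)
    linarith
  linarith

/-! ### Pairwise independence of the words of a row -/

section Hash

variable {n B : ℕ}

/-- The sum of the first word of a row and the words selected by the binary digits of `i`. -/
def rowHash (n B i : ℕ) : (Fin (n + 1) → Fin (2 ^ B)) →+ Fin (2 ^ B) where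
  toFun r := r 0 + ∑ k : Fin n, (i / 2 ^ (k : ℕ) % 2) • r k.succ
  map_zero' := by simp
  map_add' r r' := by
    simp only [Pi.add_apply, smul_add, sum_add_distrib]
    abel

theorem rowHash_apply (i : ℕ) (r : Fin (n + 1) → Fin (2 ^ B)) :
    rowHash n B i r = r 0 + ∑ k : Fin n, (i / 2 ^ (k : ℕ) % 2) • r k.succ := rfl

theorem rowHash_surjective (i : ℕ) : Function.Surjective (rowHash n B i) := fun u =>
  ⟨Fin.cons u 0, by simp [rowHash_apply]⟩

theorem exists_digit_ne {i i' : ℕ} (hi : i < 2 ^ n) (hi' : i' < 2 ^ n) (h : i ≠ i') :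
    ∃ k : Fin n, i / 2 ^ (k : ℕ) % 2 ≠ i' / 2 ^ (k : ℕ) % 2 := by
  by_contra! hk
  refine h (Nat.eq_of_testBit_eq fun k => ?_)
  rcases lt_or_ge k n with hkn | hkn
  · rw [Nat.testBit_eq_decide_div_mod_eq, Nat.testBit_eq_decide_div_mod_eq, hk ⟨k, hkn⟩]
  · rw [Nat.testBit_lt_two_pow (hi.trans_le (Nat.pow_le_pow_right (by norm_num) hkn)),
      Nat.testBit_lt_two_pow (hi'.trans_le (Nat.pow_le_pow_right (by norm_num) hkn))]

theorem rowHash_cons_single (i : ℕ) (k : Fin n) (u v : Fin (2 ^ B)) :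
    rowHash n B i (Fin.cons u (Pi.single k v)) = u + (i / 2 ^ (k : ℕ) % 2) • v := by
  rw [rowHash_apply, Fin.cons_zero, Finset.sum_eq_single k]
  · simp
  · intro l _ hl
    simp [hl]
  · simp

/-- At a digit k where the indices differ, one hash sees the word of k and the other does not. The
first word then sets the latter hash, and the word of k corrects the former. -/
theorem rowHash_prod_surjective {i i' : ℕ} (hi : i < 2 ^ n) (hi' : i' < 2 ^ n) (h : i ≠ i') :
    Function.Surjective ((rowHash n B i).prod (rowHash n B i')) := by
  rintro ⟨u, v⟩
  obtain ⟨k, hk⟩ := exists_digit_ne hi hi' h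
  have h1 : i / 2 ^ (k : ℕ) % 2 < 2 := Nat.mod_lt _ (by norm_num)
  have h2 : i' / 2 ^ (k : ℕ) % 2 < 2 := Nat.mod_lt _ (by norm_num)
  by_cases h0 : i / 2 ^ (k : ℕ) % 2 = 0
  · have h1' : i' / 2 ^ (k : ℕ) % 2 = 1 := by omega
    refine ⟨Fin.cons u (Pi.single k (v - u)), ?_⟩
    simp [rowHash_cons_single, h0, h1']
  · have h0' : i' / 2 ^ (k : ℕ) % 2 = 0 := by omega
    have h1' : i / 2 ^ (k : ℕ) % 2 = 1 := by omega
    refine ⟨Fin.cons v (Pi.single k (u - v)), ?_⟩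
    simp [rowHash_cons_single, h0', h1']

theorem unifProb_rowHash (i : ℕ) (p : Fin (2 ^ B) → Prop) :
    unifProb (fun r => p (rowHash n B i r)) = unifProb p :=
  unifProb_comp_addMonoidHom _ (rowHash_surjective i) p

theorem unifProb_rowHash_and {i i' : ℕ} (hi : i < 2 ^ n) (hi' : i' < 2 ^ n) (h : i ≠ i')
    (p p' : Fin (2 ^ B) → Prop) :
    unifProb (fun r => p (rowHash n B i r) ∧ p' (rowHash n B i' r)) = unifProb p * unifProb p' := by
  rw [← unifProb_prod]
  exact unifProb_comp_addMonoidHom ((rowHash n B i).prod (rowHash n B i'))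
    (rowHash_prod_surjective hi hi' h) fun x : Fin (2 ^ B) × Fin (2 ^ B) => p x.1 ∧ p' x.2

end Hash

/-- The random words, arranged in rows. -/
def rowEquiv (K n B : ℕ) :
    (Fin (K * (n + 1)) → Fin (2 ^ B)) ≃ (Fin K → Fin (n + 1) → Fin (2 ^ B)) :=
  ((finProdFinEquiv (m := K) (n := n + 1)).arrowCongr (Equiv.refl _)).symm.trans
    (Equiv.curry _ _ _)

theorem rowEquiv_val {K n B : ℕ} (ω : Fin (K * (n + 1)) → Fin (2 ^ B)) (j : Fin K)
    (t : Fin (n + 1)) : (rowEquiv K n B ω j t : ℕ) =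
      SketchParams.randomWord ω (j * (n + 1) + t) := by
  have hlt : (j : ℕ) * (n + 1) + t < K * (n + 1) := by
    have := Nat.mul_le_mul_right (n + 1) (Nat.succ_le_of_lt j.2)
    rw [Nat.succ_mul] at this
    omega
  have h : finProdFinEquiv (j, t) = (⟨j * (n + 1) + t, hlt⟩ : Fin (K * (n + 1))) := by
    ext
    simp [finProdFinEquiv]
    ring
  rw [SketchParams.randomWord, dif_pos hlt]
  exact congrArg (fun x => (ω x : ℕ)) h

-- The program sums naturals and reduces modulo 2^B; the cast to `Fin (2 ^ B)` carries this to the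
-- group homomorphism, to which the probabilistic lemmas apply.
open Fin.CommRing in
theorem hashWord_eq_rowHash (P : SketchParams) {N : ℕ}
    (ω : Fin (P.K * (P.n + 1)) → Fin (2 ^ P.B)) (j : Fin P.K) (i : Fin N) :
    P.hashWord ω j i = rowHash P.n P.B i (rowEquiv P.K P.n P.B ω j) := by
  have h : P.hashWord ω j i = ((SketchParams.randomWord ω (j * (P.n + 1)) +
      ∑ k ∈ range P.n, SketchParams.randomWord ω (j * (P.n + 1) + 1 + k) *
        ((i : ℕ) / 2 ^ k % 2) : ℕ) : Fin (2 ^ P.B)) := by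
    ext
    rw [Fin.val_natCast]
    rfl
  have h' : ∀ t : Fin (P.n + 1), rowEquiv P.K P.n P.B ω j t =
      ((SketchParams.randomWord ω (j * (P.n + 1) + t) : ℕ) : Fin (2 ^ P.B)) := fun t => by
    rw [← rowEquiv_val, Fin.cast_val_eq_self]
  rw [h, rowHash_apply, h', ← Fin.sum_univ_eq_sum_range (fun k =>
    SketchParams.randomWord ω (j * (P.n + 1) + 1 + k) * ((i : ℕ) / 2 ^ k % 2))]
  simp only [Nat.cast_add, Nat.cast_sum, Nat.cast_mul, h', nsmul_eq_mul, Fin.val_zero, add_zero,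
    Fin.val_succ]
  congr 1
  refine Finset.sum_congr rfl fun k _ => ?_
  rw [mul_comm, add_assoc, add_comm 1]

/-! ### Accuracy -/

theorem pointEstimate_eq_of_dominates {N K : ℕ} {f : Fin N → ℕ} {Z : Fin K → Fin N → ℚ≥0}
    {i₀ : Fin N} {j : Fin K} (hj : Z j i₀ ≠ 0)
    (h : ∀ i, (f i : ℚ≥0) * Z j i ≤ f i₀ * Z j i₀) : pointEstimate f Z i₀ = f i₀ := by
  have hjm : j ∈ univ.filter fun j => Z j i₀ ≠ 0 := by simpa using hj
  rw [pointEstimate, dif_pos ⟨j, hjm⟩]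
  refine le_antisymm ((Finset.inf'_le _ hjm).trans ?_) (Finset.le_inf' _ _ fun k hk => ?_)
  · rw [div_le_iff₀ (pos_iff_ne_zero.2 hj)]
    exact Finset.sup_le fun i _ => h i
  · rw [le_div_iff₀ (pos_iff_ne_zero.2 (mem_filter.1 hk).2)]
    exact Finset.le_sup (f := fun i => (f i : ℚ≥0) * Z k i) (mem_univ i₀)

theorem pointEstimate_zero {N K : ℕ} (Z : Fin K → Fin N → ℚ≥0) (i₀ : Fin N) :
    pointEstimate (fun _ => 0) Z i₀ = 0 := by
  have h : ∀ j, sketch (fun _ => 0) Z j = 0 := fun j =>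
    le_antisymm (Finset.sup_le fun i _ => by simp) (zero_le (a := sketch (fun _ => 0) Z j))
  unfold pointEstimate
  split_ifs with hne
  · simp [h]
  · rfl

/-- The left side of `h` is the Fréchet distribution function at τ, whose inverse is the quantile.
-/
theorem le_frechetQuantile {α u τ : ℝ} (hα : 0 < α) (hτ : 0 < τ) (hu : u < 1)
    (h : Real.exp (-τ ^ (-α)) ≤ u) : τ ≤ frechetQuantile α u := by
  have hu0 : 0 < u := (Real.exp_pos _).trans_le h
  have h1 : Real.log (1 / u) ≤ τ ^ (-α) := by
    rw [one_div, Real.log_inv, neg_le]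
    exact (Real.le_log_iff_exp_le hu0).2 h
  have h2 : 0 < Real.log (1 / u) := Real.log_pos (by rwa [lt_div_iff₀ hu0, one_mul])
  calc τ = (τ ^ (-α)) ^ (-(1 / α)) := by
        rw [← Real.rpow_mul hτ.le]
        field_simp
        simp
    _ ≤ _ := Real.rpow_le_rpow_of_nonpos h2 h1 (by simp [hα.le])

theorem frechetQuantile_le {α u τ : ℝ} (hα : 0 < α) (hτ : 0 < τ) (hu0 : 0 < u)
    (h : u ≤ Real.exp (-τ ^ (-α))) : frechetQuantile α u ≤ τ := by
  have h1 : τ ^ (-α) ≤ Real.log (1 / u) := by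
    rw [one_div, Real.log_inv, le_neg]
    exact (Real.log_le_iff_le_exp hu0).2 h
  calc _ ≤ (τ ^ (-α)) ^ (-(1 / α)) :=
        Real.rpow_le_rpow_of_nonpos (by positivity) h1 (by simp [hα.le])
    _ = τ := by
        rw [← Real.rpow_mul hτ.le]
        field_simp
        simp

/-- The union bound is taken inside the event for `i₀`. Each intersection involves two distinct
indices, so pairwise independence lets the probability of that event factor out. -/
theorem le_unifProb_row {N n B : ℕ} (hN : N ≤ 2 ^ n) {i₀ : Fin N} {s : Finset (Fin N)}
    (hs : i₀ ∉ s) (u₀ : ℝ) {u : Fin N → ℝ} (hu : ∀ i ∈ s, u i ≤ 1) :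
    unifProb (fun w : Fin (2 ^ B) => u₀ ≤ midpt w) * (1 - ∑ i ∈ s, 2 * (1 - u i)) ≤
      unifProb fun r => u₀ ≤ midpt (rowHash n B i₀ r) ∧
        ∀ i ∈ s, midpt (rowHash n B i r) ≤ u i := by
  have h1 : unifProb (fun r => u₀ ≤ midpt (rowHash n B i₀ r)) ≤
      unifProb (fun r => u₀ ≤ midpt (rowHash n B i₀ r) ∧
        ∀ i ∈ s, midpt (rowHash n B i r) ≤ u i) +
      unifProb (fun r => ∃ i ∈ s, u₀ ≤ midpt (rowHash n B i₀ r) ∧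
        u i < midpt (rowHash n B i r)) := by
    refine (unifProb_mono fun r hr => ?_).trans (unifProb_or_le _ _)
    by_cases h : ∀ i ∈ s, midpt (rowHash n B i r) ≤ u i
    · exact Or.inl ⟨hr, h⟩
    · push Not at h
      obtain ⟨i, hi, h⟩ := h
      exact Or.inr ⟨i, hi, hr, h⟩
  have h2 := unifProb_exists_le s fun i r => u₀ ≤ midpt (rowHash n B i₀ r) ∧
    u i < midpt (rowHash n B i r)
  have h3 : ∀ i ∈ s, unifProb (fun r => u₀ ≤ midpt (rowHash n B i₀ r) ∧
      u i < midpt (rowHash n B i r)) ≤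
      unifProb (fun w : Fin (2 ^ B) => u₀ ≤ midpt w) * (2 * (1 - u i)) := fun i hi => by
    rw [unifProb_rowHash_and (i₀.2.trans_le hN) (i.2.trans_le hN)
      (fun h => hs (Fin.ext h ▸ hi)) (fun w => u₀ ≤ midpt w) (fun w => u i < midpt w)]
    exact mul_le_mul_of_nonneg_left (unifProb_lt_midpt_le (hu i hi)) (unifProb_nonneg _)
  have h4 := sum_le_sum h3
  rw [← mul_sum] at h4
  rw [unifProb_rowHash (p := fun w => u₀ ≤ midpt w)] at h1
  linarith

theorem half_le_one_sub_exp_neg {y : ℝ} (h0 : 0 ≤ y) (h1 : y ≤ 1) :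
    y / 2 ≤ 1 - Real.exp (-y) := by
  have h := Real.add_one_le_exp y
  have h2 : Real.exp (-y) ≤ 1 / (y + 1) := by
    rw [Real.exp_neg, inv_eq_one_div]
    exact one_div_le_one_div_of_le (by linarith) h
  have h3 : 1 / (y + 1) ≤ 1 - y / 2 := by
    rw [div_le_iff₀ (by linarith)]
    nlinarith
  linarith

/-! ### Good rows and their probability. -/

/-- The slack of the thresholds. -/
def slack (α : ℝ) : ℝ := 1 + 4 ^ (1 / α)

/-- The constant `κ` in the number of rows. -/
def rowConst (α : ℝ) : ℝ := 8 * (slack α + 1) ^ α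

theorem one_le_slack_sub (α : ℝ) (hα : 0 < α) : 1 ≤ slack α - 1 := by
  rw [slack, add_sub_cancel_left]
  exact Real.one_le_rpow (by norm_num) (by positivity)

/-- With the value 4 the tails of all other indices sum to at most 1/4, hence to at most 1/2 after
the factor 2 lost at midpoints. -/
theorem slack_sub_rpow (α : ℝ) (hα : 0 < α) : (slack α - 1) ^ α = 4 := by
  rw [slack, add_sub_cancel_left, ← Real.rpow_mul (by norm_num)]
  field_simp
  simp

theorem eight_le_rowConst (α : ℝ) (hα : 0 < α) : 8 ≤ rowConst α := by
  have h := one_le_slack_sub α hα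
  have : 1 ≤ (slack α + 1) ^ α := Real.one_le_rpow (by linarith) hα.le
  unfold rowConst
  linarith

/-- The event that in one row the index `i₀` dominates. -/
def RowGood (α : ℝ) {N : ℕ} (n B : ℕ) (f : Fin N → ℕ) (i₀ : Fin N) (σ : ℝ)
    (r : Fin (n + 1) → Fin (2 ^ B)) : Prop :=
  Real.exp (-((slack α + 1) * σ / f i₀) ^ (-α)) ≤ midpt (rowHash n B i₀ r) ∧
    ∀ i ∈ (univ.erase i₀).filter fun i => f i ≠ 0,
      midpt (rowHash n B i r) ≤ Real.exp (-((slack α - 1) * σ / f i) ^ (-α))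

/-- The 8 in `rowConst` is a product of three factors 2: from 1 - e^(-y) ≥ y/2, from passing to
midpoints, and from the failure probability 1/2 of the other indices. -/
theorem le_unifProb_rowGood {α ε : ℝ} (hα : 0 < α) {N n B : ℕ} (hN : N ≤ 2 ^ n) (hε : 0 < ε)
    (hε1 : ε ^ α ≤ 1) (hB : rowConst α ≤ 2 ^ B * ε ^ α) {f : Fin N → ℕ} {i₀ : Fin N} {σ : ℝ}
    (hσ : 0 < σ) (hsum : ∑ i ∈ univ.erase i₀, (f i : ℝ) ^ α = σ ^ α) (hf : ε * σ ≤ f i₀) :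
    ε ^ α / rowConst α ≤ unifProb (RowGood α n B f i₀ σ) := by
  have hs := one_le_slack_sub α hα
  have hf0 : (0 : ℝ) < f i₀ := (by positivity : 0 < ε * σ).trans_le hf
  have hS : 1 ≤ (slack α + 1) ^ α := Real.one_le_rpow (by linarith) hα.le
  have hS0 : 0 < slack α + 1 := by linarith
  set y : ℝ := ε ^ α / (slack α + 1) ^ α with hy
  have hy0 : 0 < y := by positivity
  have hy1 : y ≤ 1 := by
    rw [hy, div_le_one (by positivity)]
    linarith
  have hyx : y ≤ ((slack α + 1) * σ / f i₀) ^ (-α) := by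
    rw [hy, ← Real.div_rpow hε.le hS0.le, Real.rpow_neg (by positivity), ← Real.inv_rpow
      (by positivity), inv_div]
    refine Real.rpow_le_rpow (by positivity) ?_ hα.le
    rw [div_le_div_iff₀ hS0 (by positivity)]
    nlinarith
  have hu0 : y / 2 ≤ 1 - Real.exp (-((slack α + 1) * σ / f i₀) ^ (-α)) :=
    (half_le_one_sub_exp_neg hy0.le hy1).trans (sub_le_sub_left (Real.exp_le_exp.2 (by linarith)) _)
  have hyB : 1 ≤ y / 2 * 2 ^ B := by
    rw [hy, div_div, div_mul_eq_mul_div, le_div_iff₀ (by positivity)]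
    unfold rowConst at hB
    linarith
  have hp0 := le_unifProb_le_midpt (B := B)
    (Real.exp_pos (-((slack α + 1) * σ / f i₀) ^ (-α))).le
    (hyB.trans (mul_le_mul_of_nonneg_right hu0 (by positivity)))
  have hrow := le_unifProb_row (B := B) hN (i₀ := i₀)
    (s := (univ.erase i₀).filter fun i => f i ≠ 0) (by simp)
    (Real.exp (-((slack α + 1) * σ / f i₀) ^ (-α)))
    (u := fun i => Real.exp (-((slack α - 1) * σ / f i) ^ (-α)))
    (fun i _ => Real.exp_le_one_iff.2 (neg_nonpos.2 (by positivity)))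
  have hterm : ∀ i ∈ (univ.erase i₀).filter (fun i => f i ≠ 0),
      2 * (1 - Real.exp (-((slack α - 1) * σ / f i) ^ (-α))) ≤ (f i : ℝ) ^ α / (2 * σ ^ α) := by
    intro i hi
    have hfi : (0 : ℝ) < f i := Nat.cast_pos.2 (Nat.pos_of_ne_zero (mem_filter.1 hi).2)
    have h1 : ((slack α - 1) * σ / f i) ^ (-α) = (f i : ℝ) ^ α / (4 * σ ^ α) := by
      rw [Real.rpow_neg (by positivity), Real.div_rpow (by positivity) hfi.le,
        Real.mul_rpow (by linarith) hσ.le, slack_sub_rpow α hα, inv_div]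
    have h2 := Real.add_one_le_exp (-((slack α - 1) * σ / f i) ^ (-α))
    have h3 : (f i : ℝ) ^ α / (2 * σ ^ α) = 2 * ((f i : ℝ) ^ α / (4 * σ ^ α)) := by
      field_simp
      norm_num
    rw [h3, ← h1]
    linarith
  have hsum' : ∑ i ∈ (univ.erase i₀).filter (fun i => f i ≠ 0),
      2 * (1 - Real.exp (-((slack α - 1) * σ / f i) ^ (-α))) ≤ 1 / 2 := by
    refine (sum_le_sum hterm).trans ?_
    rw [← sum_div, div_le_iff₀ (by positivity)]
    have := sum_le_sum_of_subset_of_nonneg (filter_subset (fun i => f i ≠ 0) (univ.erase i₀))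
      (f := fun i => (f i : ℝ) ^ α) fun i _ _ => by positivity
    linarith
  have hfin : ε ^ α / rowConst α = y / 8 := by
    rw [hy, rowConst, div_div, mul_comm 8]
  rw [hfin]
  refine le_trans ?_ hrow
  nlinarith

/-- Write s for `slack α`. Discretization costs `i₀` at most f(i₀) β ≤ Dσ/(D+1) ≤ σ and helps
another index by at most f(i) ≤ σ, so sσ still separates the two products. -/
theorem dominates_of_rowGood {α γ β D σ : ℝ} (hα : 0 < α) {N n B L : ℕ} (hD : 0 < D)
    (hprec : HasPrecision α L γ β) (hβ : β ≤ 1 / (D + 1)) {f : Fin N → ℕ} {i₀ : Fin N}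
    (hσ : 0 < σ) (hσf : ∀ i, i ≠ i₀ → (f i : ℝ) ≤ σ) (hf0 : 0 < f i₀) (hf : (f i₀ : ℝ) ≤ D * σ)
    {r : Fin (n + 1) → Fin (2 ^ B)} (hr : RowGood α n B f i₀ σ r)
    (hγ : ∀ i : Fin N, midpt (rowHash n B i r) ∈ Set.Icc γ (1 - γ)) :
    discFrechet α L γ (midpt (rowHash n B i₀ r)) ≠ 0 ∧
      ∀ i : Fin N, (f i : ℚ≥0) * discFrechet α L γ (midpt (rowHash n B i r)) ≤
        f i₀ * discFrechet α L γ (midpt (rowHash n B i₀ r)) := by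
  have hs := one_le_slack_sub α hα
  have hF0 : (0 : ℝ) < f i₀ := Nat.cast_pos.2 hf0
  have hβ1 : β ≤ 1 := hβ.trans (by rw [div_le_one (by linarith)]; linarith)
  have hβσ : (f i₀ : ℝ) * β ≤ σ := by
    have h1 : (f i₀ : ℝ) * β ≤ D * σ * (1 / (D + 1)) :=
      (mul_le_mul_of_nonneg_left hβ hF0.le).trans (mul_le_mul_of_nonneg_right hf (by positivity))
    refine h1.trans ?_
    rw [mul_one_div, div_le_iff₀ (by linarith)]
    nlinarith
  have hS0 : 0 < slack α + 1 := by linarith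
  have hS1 : 0 < slack α - 1 := by linarith
  have h0 : slack α * σ ≤ f i₀ * (discFrechet α L γ (midpt (rowHash n B i₀ r)) : ℝ) := by
    have h1 := le_frechetQuantile hα (by positivity) (midpt_lt_one _) hr.1
    have h2 := (abs_le.1 (hprec _ (hγ i₀))).1
    have h3 : (slack α + 1) * σ / f i₀ - β ≤
        (discFrechet α L γ (midpt (rowHash n B i₀ r)) : ℝ) := by linarith
    have h4 := mul_le_mul_of_nonneg_left h3 hF0.le
    rw [mul_sub, mul_div_cancel₀ _ hF0.ne'] at h4
    linarith
  refine ⟨fun h => ?_, fun i => ?_⟩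
  · rw [h] at h0
    have : 0 < slack α * σ := by
      apply mul_pos _ hσ
      linarith
    simp at h0
    linarith
  · rcases eq_or_ne i i₀ with rfl | hi
    · exact le_rfl
    rcases Nat.eq_zero_or_pos (f i) with hfi | hfi
    · simp [hfi]
    have hFi : (0 : ℝ) < f i := Nat.cast_pos.2 hfi
    have h1 := frechetQuantile_le (τ := (slack α - 1) * σ / f i) hα (by positivity) (midpt_pos _)
      (hr.2 i (by simp [hi, hfi.ne']))
    have h2 := (abs_le.1 (hprec _ (hγ i))).2
    have h3 : (discFrechet α L γ (midpt (rowHash n B i r)) : ℝ) ≤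
      (slack α - 1) * σ / f i + 1 := by linarith
    have h4 := mul_le_mul_of_nonneg_left h3 hFi.le
    rw [mul_add, mul_div_cancel₀ _ hFi.ne'] at h4
    have h5 := hσf i hi
    have h6 : (f i : ℝ) * (discFrechet α L γ (midpt (rowHash n B i r)) : ℝ) ≤
      f i₀ * (discFrechet α L γ (midpt (rowHash n B i₀ r)) : ℝ) := by linarith
    exact_mod_cast h6

theorem frechetConst_nonneg {α : ℝ} (hα : 0 < α) : 0 ≤ frechetConst α := by
  unfold frechetConst
  positivity

theorem one_sub_pow_le {δ x p : ℝ} {K : ℕ} (hδ : 0 < δ) (hp : p ≤ 1) (hx : x ≤ p)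
    (hK : Real.log (1 / δ) ≤ x * K) : (1 - p) ^ K ≤ δ := by
  calc (1 - p) ^ K ≤ Real.exp (-x) ^ K := by
        refine pow_le_pow_left₀ (by linarith) ?_ K
        have := Real.add_one_le_exp (-x)
        linarith
    _ = Real.exp (-(x * K)) := by rw [← Real.exp_nat_mul]; ring_nf
    _ ≤ Real.exp (-Real.log (1 / δ)) := Real.exp_le_exp.2 (by linarith)
    _ = δ := by rw [one_div, Real.log_inv, neg_neg, Real.exp_log hδ]

theorem unifProb_hashWord (P : SketchParams) {N : ℕ} (j : Fin P.K) (i : Fin N)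
    (p : Fin (2 ^ P.B) → Prop) : unifProb (fun ω => p (P.hashWord ω j i)) = unifProb p := by
  simp only [hashWord_eq_rowHash]
  rw [unifProb_congr_equiv (rowEquiv P.K P.n P.B) fun r => p (rowHash P.n P.B i (r j))]
  refine unifProb_comp_addMonoidHom ((rowHash P.n P.B i).comp
    (Pi.evalAddMonoidHom (fun _ : Fin P.K => Fin (P.n + 1) → Fin (2 ^ P.B)) j)) ?_ p
  exact (rowHash_surjective _).comp (Function.surjective_eval j)

theorem accuracy {α ε δ D γ β : ℝ} (hα : 0 < α) {N L : ℕ} {P : SketchParams}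
    (hN : N ≤ 2 ^ P.n) (hε : 0 < ε) (hε1 : ε ^ α ≤ 1) (hδ : 0 < δ) (hD : 0 < D) (hγ0 : 0 ≤ γ)
    (hγ : 4 * P.K * N * γ ≤ δ) (hK : rowConst α * Real.log (1 / δ) / ε ^ α ≤ P.K)
    (hB : rowConst α ≤ 2 ^ P.B * ε ^ α) (hprec : HasPrecision α L γ β)
    (hβ : β ≤ ε ^ α / (D + 1)) {f : Fin N → ℕ} {i₀ : Fin N} (hf : IsLargeAt α ε D f i₀) :
    1 - 3 * δ ≤ unifProb fun ω =>
      pointEstimate f (pseudoFrechet α L γ (P.hashWord ω)) i₀ = (f i₀ : ℚ≥0) := by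
  have hsum0 : 0 ≤ ∑ i ∈ univ.erase i₀, (f i : ℝ) ^ α := sum_nonneg fun i _ => by positivity
  have hsum : ∑ i, (f i : ℝ) ^ α = f i₀ ^ α + ∑ i ∈ univ.erase i₀, (f i : ℝ) ^ α :=
    (add_sum_erase _ _ (mem_univ i₀)).symm
  have hC := frechetConst_nonneg hα
  -- If `f i₀ = 0`, the lower bound in `IsLargeAt` forces the whole signal to vanish, and the
  -- estimate is always 0.
  rcases Nat.eq_zero_or_pos (f i₀) with hf0 | hf0
  · have h1 : (∑ i, (f i : ℝ) ^ α) ^ (1 / α) = 0 := by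
      have h := hf.1
      rw [hf0, Nat.cast_zero] at h
      refine le_antisymm ?_ (by positivity)
      by_contra! h0
      have : 0 < 2 * (1 + frechetConst α) * ε * (∑ i, (f i : ℝ) ^ α) ^ (1 / α) := by positivity
      linarith
    rw [Real.rpow_eq_zero (by positivity) (by positivity),
      sum_eq_zero_iff_of_nonneg fun i _ => by positivity] at h1
    have hfz : f = fun _ => 0 := by
      funext i
      have := h1 i (mem_univ i)
      rwa [Real.rpow_eq_zero (by positivity) hα.ne', Nat.cast_eq_zero] at this
    have h2 := unifProb_add_not
      fun ω => pointEstimate f (pseudoFrechet α L γ (P.hashWord ω)) i₀ = (f i₀ : ℚ≥0)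
    have h3 : unifProb (fun ω =>
        ¬pointEstimate f (pseudoFrechet α L γ (P.hashWord ω)) i₀ = (f i₀ : ℚ≥0)) = 0 := by
      subst hfz
      simp [pointEstimate_zero, unifProb]
    linarith
  have hF0 : (0 : ℝ) < f i₀ := Nat.cast_pos.2 hf0
  set σ : ℝ := (∑ i ∈ univ.erase i₀, (f i : ℝ) ^ α) ^ (1 / α) with hσdef
  have hσ0 : 0 ≤ σ := by positivity
  -- The upper bound through D excludes a signal supported at `i₀` alone.
  have hσ : 0 < σ := by
    have := hf.2
    by_contra! h
    have h0 : σ = 0 := le_antisymm h hσ0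
    rw [← hσdef, h0] at this
    linarith
  have hσα : ∑ i ∈ univ.erase i₀, (f i : ℝ) ^ α = σ ^ α := by
    rw [hσdef, ← Real.rpow_mul hsum0]
    field_simp
    simp
  have hσf : ∀ i, i ≠ i₀ → (f i : ℝ) ≤ σ := fun i hi => by
    rw [← Real.rpow_le_rpow_iff (by positivity) hσ0 hα, ← hσα]
    exact single_le_sum (f := fun i => (f i : ℝ) ^ α) (fun i _ => by positivity)
      (mem_erase.2 ⟨hi, mem_univ i⟩)
  have hεσ : ε * σ ≤ f i₀ := by
    refine le_trans ?_ hf.1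
    have h1 : σ ≤ (∑ i, (f i : ℝ) ^ α) ^ (1 / α) := by
      refine Real.rpow_le_rpow hsum0 ?_ (by positivity)
      rw [hsum]
      have : (0 : ℝ) ≤ (f i₀ : ℝ) ^ α := by positivity
      linarith
    have h2 : ε ≤ 2 * (1 + frechetConst α) * ε := by nlinarith
    exact mul_le_mul h2 h1 hσ0 (by positivity)
  have hβ' : β ≤ 1 / (D + 1) := hβ.trans (by gcongr)
  let bad : (Fin (P.K * (P.n + 1)) → Fin (2 ^ P.B)) → Prop := fun ω =>
    ∃ x ∈ (univ : Finset (Fin P.K × Fin N)), midpt (P.hashWord ω x.1 x.2) < γ ∨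
      1 - γ < midpt (P.hashWord ω x.1 x.2)
  have hbad : unifProb bad ≤ δ := by
    refine (unifProb_exists_le _ _).trans ?_
    have h1 : ∀ x ∈ (univ : Finset (Fin P.K × Fin N)), unifProb (fun ω =>
        midpt (P.hashWord ω x.1 x.2) < γ ∨ 1 - γ < midpt (P.hashWord ω x.1 x.2)) ≤ 4 * γ := by
      intro x _
      refine (unifProb_or_le _ _).trans ?_
      rw [unifProb_hashWord P x.1 x.2 fun w => midpt w < γ,
        unifProb_hashWord P x.1 x.2 fun w => 1 - γ < midpt w]
      have h1 := unifProb_midpt_lt_le (B := P.B) hγ0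
      have h2 := unifProb_lt_midpt_le (B := P.B) (u := 1 - γ) (by linarith)
      linarith
    refine (sum_le_sum h1).trans ?_
    simp only [sum_const, card_univ, Fintype.card_prod, Fintype.card_fin, nsmul_eq_mul,
      Nat.cast_mul]
    linarith
  have hgood := le_unifProb_rowGood hα hN hε hε1 hB hσ hσα hεσ
  have hnone : unifProb (fun ω => ∀ j, ¬RowGood α P.n P.B f i₀ σ (rowEquiv P.K P.n P.B ω j)) ≤
      δ := by
    rw [unifProb_congr_equiv (rowEquiv P.K P.n P.B)
      (fun r => ∀ j, ¬RowGood α P.n P.B f i₀ σ (r j)),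
      unifProb_forall fun r => ¬RowGood α P.n P.B f i₀ σ r]
    have h1 := unifProb_add_not (RowGood α P.n P.B f i₀ σ)
    have h2 := unifProb_nonneg fun r => ¬RowGood α P.n P.B f i₀ σ r
    rw [eq_sub_of_add_eq' h1]
    refine one_sub_pow_le hδ (by linarith) hgood ?_
    have hκ : 0 < rowConst α := by linarith [eight_le_rowConst α hα]
    rw [div_le_iff₀ (by positivity)] at hK
    rw [div_mul_eq_mul_div, le_div_iff₀ hκ]
    linarith
  have hfail : unifProb (fun ω =>
      ¬pointEstimate f (pseudoFrechet α L γ (P.hashWord ω)) i₀ = (f i₀ : ℚ≥0)) ≤ 2 * δ := by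
    refine (unifProb_mono (p' := fun ω => (∀ j, ¬RowGood α P.n P.B f i₀ σ
      (rowEquiv P.K P.n P.B ω j)) ∨ bad ω) fun ω hω => ?_).trans ((unifProb_or_le _ _).trans ?_)
    · by_contra! h
      obtain ⟨⟨j, hj⟩, hb⟩ := h
      simp only [bad, mem_univ, true_and, not_exists, not_or, not_lt] at hb
      obtain ⟨h1, h2⟩ := dominates_of_rowGood (N := N) hα hD hprec hβ' hσ hσf hf0 hf.2 hj
        fun i => by
          have := hb (j, i)
          rwa [hashWord_eq_rowHash] at this
      refine hω (pointEstimate_eq_of_dominates (j := j) ?_ fun i => ?_)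
      · have : pseudoFrechet α L γ (P.hashWord ω) j i₀ = discFrechet α L γ
            (midpt (P.hashWord ω j i₀)) := rfl
        rw [this, hashWord_eq_rowHash]
        exact h1
      · have : ∀ i : Fin N, pseudoFrechet α L γ (P.hashWord ω) j i = discFrechet α L γ
            (midpt (P.hashWord ω j i)) := fun i => rfl
        rw [this, this, hashWord_eq_rowHash, hashWord_eq_rowHash]
        exact h2 i
    · linarith
  have h2 := unifProb_add_not
    fun ω => pointEstimate f (pseudoFrechet α L γ (P.hashWord ω)) i₀ = (f i₀ : ℚ≥0)
  linarith

/-! ### The size of the grid -/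

theorem rpow_le_frechetQuantile {α γ : ℝ} (hα : 0 < α) (h0 : 0 < γ) (h1 : γ < 1 / 2) :
    (2 * γ) ^ (-(1 / α)) ≤ frechetQuantile α (1 - γ) := by
  have h2 : 0 < 1 - γ := by linarith
  have h3 : 1 < 1 / (1 - γ) := by
    rw [lt_div_iff₀ h2]
    linarith
  have h4 : Real.log (1 / (1 - γ)) ≤ 2 * γ := by
    refine (Real.log_le_sub_one_of_pos (by positivity)).trans ?_
    rw [sub_le_iff_le_add, div_le_iff₀ h2]
    nlinarith
  exact Real.rpow_le_rpow_of_nonpos (Real.log_pos h3) h4 (by simp [hα.le])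

theorem HasPrecision.rpow_le {α γ β : ℝ} {L : ℕ} (h : HasPrecision α L γ β) (hα : 0 < α)
    (h0 : 0 < γ) (h1 : γ < 1 / 2) (hβ : β ≤ 1) :
    (2 * γ) ^ (-(1 / α)) ≤ discFrechet α L γ (1 - γ) + 1 := by
  have := (abs_le.1 (h (1 - γ) ⟨by linarith, le_rfl⟩)).1
  linarith [rpow_le_frechetQuantile hα h0 h1]

/-- For L = 1 the clamp at 1-γ sends every uniform to grid index 0, with value 0, while the quantile
at 1-γ exceeds 1. -/
theorem HasPrecision.two_le {α γ β : ℝ} {L : ℕ} (h : HasPrecision α L γ β) (hα : 0 < α)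
    (hL : 0 < L) (h0 : 0 < γ) (h1 : γ < 1 / 2) (hβ : β ≤ 1) : 2 ≤ L := by
  by_contra! hL2
  obtain rfl : L = 1 := by omega
  have hfl : ⌊(1 - γ) * (1 : ℕ)⌋₊ = 0 := Nat.floor_eq_zero.2 (by push_cast; linarith)
  have hz : (discFrechet α 1 γ (1 - γ) : ℝ) = 0 := by
    -- The conventions for 1/0, log 0 and powers of 0 give the limit value of the quantile at 0.
    have hq : frechetQuantile α ((0 : ℕ) / (1 : ℕ)) = 0 := by
      simp [frechetQuantile, Real.zero_rpow, hα.ne']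
    have := abs_nearest_sub_le (0 : ℝ) (zero_mem_ratGrid one_pos)
    rw [discFrechet, gridIndex, hfl, Nat.min_zero, discQuantile, hq]
    simpa using this
  have h2 := h.rpow_le hα h0 h1 hβ
  have h3 : 1 < (2 * γ) ^ (-(1 / α)) :=
    Real.one_lt_rpow_of_pos_of_lt_one_of_neg (by linarith) (by linarith) (by simp [hα])
  rw [hz] at h2
  linarith

theorem HasPrecision.inv_le {α γ β : ℝ} {L : ℕ} (h : HasPrecision α L γ β) (hα : 0 < α)
    (hL : 0 < L) (h0 : 0 < γ) (h1 : γ < 1 / 2) (hβ : β ≤ 1) :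
    (2 * γ)⁻¹ ≤ (2 * L : ℝ) ^ α := by
  have h2 := h.rpow_le hα h0 h1 hβ
  have h3 : (discFrechet α L γ (1 - γ) : ℝ) ≤ L := by
    exact_mod_cast le_of_mem_ratGrid (discQuantile_mem hL α (gridIndex L γ (1 - γ)))
  have h4 : (1 : ℝ) ≤ L := Nat.one_le_cast.2 hL
  calc (2 * γ)⁻¹ = ((2 * γ) ^ (-(1 / α))) ^ α := by
        rw [← Real.rpow_mul (by linarith), ← Real.rpow_neg_one]
        congr 1
        field_simp
    _ ≤ _ := Real.rpow_le_rpow (by positivity) (by linarith) hα.le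

/-! ### Word length, memory and time. -/

theorem clog_le_two_mul_logb {x : ℕ} (hx : 2 ≤ x) : (Nat.clog 2 x : ℝ) ≤ 2 * Real.logb 2 x := by
  have h1 : 2 ^ (Nat.clog 2 x - 1) < x := Nat.pow_pred_clog_lt_self (by norm_num) (by omega)
  have hpos : 0 < Nat.clog 2 x := Nat.clog_pos (by norm_num) hx
  have hx0 : (0 : ℝ) < x := by positivity
  have h2 : ((Nat.clog 2 x - 1 : ℕ) : ℝ) ≤ Real.logb 2 x := by
    rw [Real.le_logb_iff_rpow_le (by norm_num) hx0, Real.rpow_natCast]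
    exact_mod_cast h1.le
  have h3 : 1 ≤ Real.logb 2 x := by
    rw [Real.le_logb_iff_rpow_le (by norm_num) hx0, Real.rpow_one]
    exact_mod_cast hx
  rw [Nat.cast_sub hpos] at h2
  push_cast at h2
  linarith

theorem clog_lt_self {x : ℕ} (hx : 2 ≤ x) : Nat.clog 2 x < x := by
  have h1 : 2 ^ (Nat.clog 2 x - 1) < x := Nat.pow_pred_clog_lt_self (by norm_num) (by omega)
  have h2 : Nat.clog 2 x - 1 < 2 ^ (Nat.clog 2 x - 1) := Nat.lt_two_pow_self
  omega

/-- Words of `(7 + a + a') ℓ` bits are large enough if the number of rows times the number of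
indices is at most `2 ^ (a ℓ)`. -/
theorem fits_of_le {α : ℝ} {K N L ℓ a a' lo hi : ℕ} (hK : 0 < K) (hN : 2 ≤ N) (hL : 0 < L)
    (hℓ : 0 < ℓ) (hLℓ : L ≤ 2 ^ ℓ) (hKN : K * N ≤ 2 ^ (a * ℓ)) (hlo : lo ≤ L) (hhi : hi ≤ L) :
    (⟨K, Nat.clog 2 N, (2 + a + a') * ℓ, L, lo, hi⟩ : SketchParams).Fits (discQuantile α L)
      (26 + K * (Nat.clog 2 N + 1) + K) ((7 + a + a') * ℓ) where
  memory := le_rfl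
  address := by
    have h1 : K * (Nat.clog 2 N + 1) ≤ K * N := Nat.mul_le_mul_left _ (clog_lt_self hN)
    have h2 : K ≤ K * N := Nat.le_mul_of_pos_right _ (by omega)
    -- The memory has at most 26 + 2 · 2^(aℓ) cells, fewer than 32 · 2^(aℓ).
    have h3 : 2 ^ (5 + a * ℓ) ≤ 2 ^ ((7 + a + a') * ℓ) :=
      Nat.pow_le_pow_right (by norm_num) (by nlinarith [Nat.zero_le (a' * ℓ)])
    rw [pow_add] at h3
    have h4 : 0 < 2 ^ (a * ℓ) := by positivity
    omega
  fine := by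
    show 2 ^ ((2 + a + a') * ℓ + 2) * L < _
    calc 2 ^ ((2 + a + a') * ℓ + 2) * L ≤ 2 ^ ((2 + a + a') * ℓ + 2) * 2 ^ ℓ :=
          Nat.mul_le_mul_left _ hLℓ
      _ = 2 ^ ((2 + a + a') * ℓ + 2 + ℓ) := by rw [pow_add _ _ ℓ]
      _ < 2 ^ ((7 + a + a') * ℓ) := Nat.pow_lt_pow_right (by norm_num) (by nlinarith)
  values := by
    show L ^ 5 < _
    calc L ^ 5 ≤ (2 ^ ℓ) ^ 5 := Nat.pow_le_pow_left hLℓ 5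
      _ = 2 ^ (ℓ * 5) := by rw [pow_mul]
      _ < 2 ^ ((7 + a + a') * ℓ) :=
        Nat.pow_lt_pow_right (by norm_num)
          (by nlinarith [Nat.zero_le (a' * ℓ), Nat.zero_le (a * ℓ)])
  pos := hL
  rows := hK
  low := hlo
  high := hhi
  num k := num_le_of_mem_ratGrid (discQuantile_mem hL α k)
  den k := Nat.le_of_dvd hL (den_dvd_of_mem_ratGrid (discQuantile_mem hL α k))

theorem unifProb_eq_apply {B : ℕ} (v : Fin (2 ^ B)) : unifProb (fun w => w = v) = 1 / 2 ^ B := by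
  simp [unifProb]

/-- The 44 = 10 + 29 + 5 covers the running time and also the number of cells; 176 adds a factor 2
for each of the two rounded logarithms. -/
theorem cost_le {x Λ ν Y k c M κ' : ℝ} {b ℓ n K : ℕ} (hx : x ≤ 44 * (K * n))
    (hb : (b : ℝ) = M * ℓ) (hℓ : (ℓ : ℝ) ≤ 2 * (c * Λ)) (hn : (n : ℝ) ≤ 2 * ν)
    (hK : (K : ℝ) ≤ κ' * Y) (hM : 0 ≤ M) (hk : k = Λ * ν * Y) :
    x * b ≤ 176 * M * c * κ' * k := by
  have h1 : (b : ℝ) ≤ M * (2 * (c * Λ)) := hb ▸ mul_le_mul_of_nonneg_left hℓ hM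
  have h2 : (K : ℝ) * n ≤ κ' * Y * (2 * ν) :=
    mul_le_mul hK hn (Nat.cast_nonneg _) ((Nat.cast_nonneg K).trans hK)
  have h3 : (K : ℝ) * n * b ≤ κ' * Y * (2 * ν) * (M * (2 * (c * Λ))) :=
    mul_le_mul h2 h1 (Nat.cast_nonneg _) (le_trans (by positivity) h2)
  calc x * b ≤ 44 * (K * n) * b := mul_le_mul_of_nonneg_right hx (Nat.cast_nonneg _)
    _ = 44 * (K * n * b) := by ring
    _ ≤ 44 * (κ' * Y * (2 * ν) * (M * (2 * (c * Λ)))) := by linarith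
    _ = _ := by rw [hk]; ring

theorem HasPrecision.mul_le_two_pow {α γ β : ℝ} {K N L ℓ : ℕ} (hprec : HasPrecision α L γ β)
    (hα : 0 < α) (hL : 0 < L) (hγ : 0 < γ) (hγ2 : γ < 1 / 2) (hβ : β ≤ 1) (hℓ0 : 0 < ℓ)
    (hLℓ : L ≤ 2 ^ ℓ) (hKNγ : 4 * K * N * γ < 1) : K * N ≤ 2 ^ (⌈2 * α⌉₊ * ℓ) := by
  have h1 := hprec.inv_le hα hL hγ hγ2 hβ
  have h2 : (K : ℝ) * N ≤ (2 * γ)⁻¹ := by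
    rw [← one_div, le_div_iff₀ (by linarith)]
    have : 0 ≤ (K : ℝ) * N * γ := by positivity
    linarith
  have h3 : (2 * L : ℝ) ≤ (2 : ℝ) ^ (2 * (ℓ : ℝ)) := by
    have : 2 * L ≤ 2 ^ (2 * ℓ) := by
      calc 2 * L ≤ 2 ^ ℓ * 2 ^ ℓ := Nat.mul_le_mul (Nat.le_self_pow hℓ0.ne' 2) hLℓ
        _ = 2 ^ (2 * ℓ) := by ring
    have h := (Nat.cast_le (α := ℝ)).2 this
    push_cast at h
    rw [← Real.rpow_natCast] at h
    push_cast at h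
    exact h
  have h4 : (2 * L : ℝ) ^ α ≤ (2 : ℝ) ^ ((⌈2 * α⌉₊ : ℝ) * ℓ) := by
    refine (Real.rpow_le_rpow (by positivity) h3 hα.le).trans ?_
    rw [← Real.rpow_mul (by norm_num)]
    refine Real.rpow_le_rpow_of_exponent_le (by norm_num) ?_
    have := mul_le_mul_of_nonneg_right (Nat.le_ceil (2 * α)) (Nat.cast_nonneg (α := ℝ) ℓ)
    linarith
  have h5 : (K : ℝ) * N ≤ (2 : ℝ) ^ ((⌈2 * α⌉₊ : ℝ) * ℓ) := h2.trans (h1.trans h4)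
  rw [← Nat.cast_mul ⌈2 * α⌉₊, Real.rpow_natCast] at h5
  exact_mod_cast h5

/-- The fineness of the words relative to e follows from the choice of K: κ/e is at most K/lam,
where K is bounded by 2^(aℓ) and 1/lam by 2^a'. -/
theorem le_two_pow_mul {κ l lam e : ℝ} {K N ℓ a a' : ℕ} (he : 0 < e) (hκ : 0 ≤ κ) (hN : 0 < N)
    (hℓ : 0 < ℓ) (hlam0 : 0 < lam) (hlam : lam ≤ l) (ha' : 1 / lam < 2 ^ a')
    (hK : κ * l / e ≤ K) (hKN : K * N ≤ 2 ^ (a * ℓ)) : κ ≤ 2 ^ ((2 + a + a') * ℓ) * e := by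
  have h1 : κ ≤ K * (1 / lam) * e := by
    rw [div_le_iff₀ he] at hK
    rw [mul_one_div, div_mul_eq_mul_div, le_div_iff₀ hlam0]
    exact (mul_le_mul_of_nonneg_left hlam hκ).trans hK
  have h2 : (K : ℝ) ≤ 2 ^ (a * ℓ) := by
    have := (Nat.le_mul_of_pos_right K hN).trans hKN
    exact_mod_cast this
  have h3 : (2 : ℝ) ^ (a * ℓ) * 2 ^ a' ≤ 2 ^ ((2 + a + a') * ℓ) := by
    rw [← pow_add]
    exact pow_le_pow_right₀ (by norm_num) (by nlinarith)
  refine h1.trans (mul_le_mul_of_nonneg_right (le_trans ?_ h3) he.le)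
  exact mul_le_mul h2 ha'.le (by positivity) (by positivity)

theorem ceil_le_mul {κ l lam e : ℝ} (he : 0 < e) (he1 : e ≤ 1) (hκ : 0 ≤ κ) (hlam0 : 0 < lam)
    (hlam : lam ≤ l) : (⌈κ * l / e⌉₊ : ℝ) ≤ (κ + 1 / lam) * (l / e) := by
  have hl : 0 < l := hlam0.trans_le hlam
  have h1 : (⌈κ * l / e⌉₊ : ℝ) < κ * l / e + 1 := Nat.ceil_lt_add_one (by positivity)
  have h2 : 1 ≤ 1 / lam * (l / e) := by
    rw [one_div, inv_mul_eq_div, le_div_iff₀ hlam0, one_mul, le_div_iff₀ he]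
    exact (mul_le_of_le_one_right hlam0.le he1).trans hlam
  rw [add_mul, ← mul_div_assoc]
  linarith

end

/-! ### Choice of the parameters. -/

theorem theorem5 (α : ℝ) (hα : 0 < α) :
    ∃ κ : ℝ, 1 ≤ κ ∧ ∃ (h : ℕ) (upd qry : Cmd), ∀ c δ₀ : ℝ, 0 < c → δ₀ < 1 → ∃ C : ℝ,
      ∀ (N L K : ℕ) (ε δ D γ β : ℝ), 2 ≤ N → 0 < L →
        0 < ε → ε < (α / (α + 1)) ^ (1 / α ^ 2) → 0 < δ → δ ≤ δ₀ → 0 < D →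
        K = ⌈κ * Real.log (1 / δ) / ε ^ α⌉₊ →
        0 < γ → γ < δ / (4 * K * N) →
        HasPrecision α L γ β → β ≤ ε ^ α / (D + 1) →
        Real.logb 2 L ≤ c * Real.logb 2 (D * N / (ε * δ)) →
        ∃ (m b R B T : ℕ) (hdr : Fin h → Fin (2 ^ b))
          (W : (Fin R → Fin (2 ^ B)) → Fin K → Fin N → Fin (2 ^ B)),
          -- the memory holds the parameters and the random words
          2 + h + R ≤ m ∧ B ≤ b ∧
          -- space and bit operations per stream item
          (m * b : ℝ) ≤ C * (Real.logb 2 (D * N / (ε * δ)) * Real.logb 2 N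
              * Real.log (1 / δ) / ε ^ α) ∧
          (T * b : ℝ) ≤ C * (Real.logb 2 (D * N / (ε * δ)) * Real.logb 2 N
              * Real.log (1 / δ) / ε ^ α) ∧
          -- each pseudorandom word is uniformly distributed, and finer than the grid
          L ^ 2 ≤ 2 ^ B ∧
          (∀ j i v, unifProb (fun ω => W ω j i = v) = 1 / 2 ^ B) ∧
          -- the programs implement the point estimator, on every signal and stream
          (∀ (ω : Fin R → Fin (2 ^ B)) (f : Fin N → ℕ) (S : List (Fin N × ℕ)),
            (∀ i, f i ≤ L) → IsStreamOf S f →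
            ∃ s : Memory m b, ReadsStream (discQuantile α L) upd T S (startMemory hdr ω) s ∧
              ∀ i₀ : Fin N, Answers (discQuantile α L) qry s i₀
                (pointEstimate f (pseudoFrechet α L γ (W ω)) i₀)) ∧
          -- the point estimator is exact with probability at least `1 - 3 δ`
          (∀ (f : Fin N → ℕ) (i₀ : Fin N), (∀ i, f i ≤ L) → IsLargeAt α ε D f i₀ →
            1 - 3 * δ ≤
              unifProb fun ω => pointEstimate f (pseudoFrechet α L γ (W ω)) i₀ = (f i₀ : ℚ≥0)) := by
  have hκ := eight_le_rowConst α hα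
  refine ⟨rowConst α, by linarith, 24, SketchParams.updateProg, SketchParams.queryProg,
    fun c δ₀ hc hδ₀ => ?_⟩
  -- A positive lower bound for ln(1/δ) that is uniform in δ ≤ δ₀; the maximum with 1/2 keeps it
  -- meaningful for every real δ₀ < 1.
  set lam : ℝ := Real.log (1 / max δ₀ (1 / 2)) with hlam
  have hmax : max δ₀ (1 / 2) < 1 := max_lt hδ₀ (by norm_num)
  have hmax0 : 0 < max δ₀ (1 / 2) := lt_max_of_lt_right (by norm_num)
  have hlam0 : 0 < lam := Real.log_pos (by rwa [lt_div_iff₀ hmax0, one_mul])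
  obtain ⟨a', ha'⟩ := pow_unbounded_of_one_lt (1 / lam) (one_lt_two : (1 : ℝ) < 2)
  set a : ℕ := ⌈2 * α⌉₊
  refine ⟨176 * ((7 + a + a' : ℕ) : ℝ) * c * (rowConst α + 1 / lam), ?_⟩
  intro N L K ε δ D γ β hN hL hε hε' hδ hδδ₀ hD hK hγ hγ' hprec hβ hLD
  have hN0 : (0 : ℝ) < N := by positivity
  have hδ1 : δ < 1 := hδδ₀.trans_lt hδ₀
  have hε1 : ε ^ α ≤ 1 := by
    refine Real.rpow_le_one hε.le (hε'.le.trans (Real.rpow_le_one (by positivity) ?_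
      (by positivity))) hα.le
    rw [div_le_one (by positivity)]
    linarith
  have hεα : 0 < ε ^ α := Real.rpow_pos_of_pos hε α
  have hβ1 : β ≤ 1 := by
    refine hβ.trans ?_
    rw [div_le_one (by linarith)]
    linarith
  have hK0 : 0 < K := by
    rcases Nat.eq_zero_or_pos K with h | h
    -- For K = 0 the quotient δ/(4KN) is 0 by convention, contrary to 0 < γ.
    · rw [h] at hγ'
      simp at hγ'
      linarith
    · exact h
  have hK1 : (1 : ℝ) ≤ K := Nat.one_le_cast.2 hK0
  have hN2 : (2 : ℝ) ≤ N := by exact_mod_cast hN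
  have hKNγ : 4 * K * N * γ < δ := by
    rw [lt_div_iff₀ (by positivity)] at hγ'
    linarith
  have hKN2 : 2 ≤ (K : ℝ) * N := by
    linarith [mul_le_mul hK1 hN2 (by norm_num) (by linarith)]
  have hγ2 : γ < 1 / 2 := by nlinarith
  have hL2 := hprec.two_le hα hL hγ hγ2 hβ1
  set ℓ := Nat.clog 2 L with hℓ
  have hℓ0 : 0 < ℓ := Nat.clog_pos (by norm_num) hL2
  have hLℓ : L ≤ 2 ^ ℓ := Nat.le_pow_clog (by norm_num) L
  have hKN : K * N ≤ 2 ^ (a * ℓ) :=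
    hprec.mul_le_two_pow hα hL hγ hγ2 hβ1 hℓ0 hLℓ (hKNγ.trans hδ1)
  have hlamδ : lam ≤ Real.log (1 / δ) := Real.log_le_log (by positivity)
    (one_div_le_one_div_of_le hδ (hδδ₀.trans (le_max_left _ _)))
  have hlogδ : 0 < Real.log (1 / δ) := hlam0.trans_le hlamδ
  have hlo : ⌈γ * L⌉₊ ≤ L := Nat.ceil_le.2 (by nlinarith)
  have hhi : ⌊(1 - γ) * L⌋₊ ≤ L := Nat.floor_le_of_le (by nlinarith)
  have hF := fits_of_le (α := α) (a' := a') hK0 hN hL hℓ0 hLℓ hKN hlo hhi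
  have hKc : rowConst α * Real.log (1 / δ) / ε ^ α ≤ K := hK ▸ Nat.le_ceil _
  have hB : rowConst α ≤ 2 ^ ((2 + a + a') * ℓ) * ε ^ α :=
    le_two_pow_mul hεα (by linarith) (by omega) hℓ0 hlam0 hlamδ ha' hKc hKN
  have hY : (K : ℝ) ≤ (rowConst α + 1 / lam) * (Real.log (1 / δ) / ε ^ α) :=
    hK ▸ ceil_le_mul hεα hε1 (by linarith) hlam0 hlamδ
  have hn0 : 0 < Nat.clog 2 N := Nat.clog_pos (by norm_num) hN
  have hn1 : (1 : ℝ) ≤ Nat.clog 2 N := Nat.one_le_cast.2 hn0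
  have hℓΛ : (ℓ : ℝ) ≤ 2 * (c * Real.logb 2 (D * N / (ε * δ))) :=
    (clog_le_two_mul_logb hL2).trans (by linarith)
  have hKn : (K : ℝ) ≤ K * Nat.clog 2 N := by nlinarith
  have hcost := fun (x : ℝ) (hx : x ≤ 44 * (K * Nat.clog 2 N)) =>
    cost_le (b := (7 + a + a') * ℓ) (M := ((7 + a + a' : ℕ) : ℝ))
    (k := Real.logb 2 (D * N / (ε * δ)) * Real.logb 2 N * Real.log (1 / δ) / ε ^ α)
    hx (Nat.cast_mul _ _) hℓΛ (clog_le_two_mul_logb hN) hY (Nat.cast_nonneg _)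
    (by rw [mul_div_assoc])
  clear_value ℓ a lam
  have hn2 := Nat.le_pow_clog (by norm_num : 1 < 2) N
  generalize Nat.clog 2 N = n at *
  have hNb : N ≤ 2 ^ ((7 + a + a') * ℓ) :=
    ((Nat.le_mul_of_pos_left N hK0).trans hKN).trans
      (Nat.pow_le_pow_right (by norm_num) (Nat.mul_le_mul_right _ (by omega)))
  -- In the random word length, 2ℓ bits give 2^B ≥ L², and the further (a + a')ℓ bits make the words
  -- fine enough for events of probability of order ε^α.
  refine ⟨26 + K * (n + 1) + K, (7 + a + a') * ℓ, K * (n + 1), (2 + a + a') * ℓ,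
    K * (10 * n + 29) + 5,
    SketchParams.header ⟨K, n, (2 + a + a') * ℓ, L, ⌈γ * L⌉₊, ⌊(1 - γ) * L⌋₊⟩ _,
    SketchParams.hashWord ⟨K, n, (2 + a + a') * ℓ, L, ⌈γ * L⌉₊, ⌊(1 - γ) * L⌋₊⟩,
    Nat.le_add_right _ K, Nat.mul_le_mul_right ℓ (by omega : 2 + a + a' ≤ 7 + a + a'),
    hcost _ ?_, hcost _ ?_, ?_, fun j i v => ?_, fun ω f S hf hS =>
    SketchParams.implements hF rfl rfl hNb ω hf hS, fun f i₀ _ hf =>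
    accuracy (P := ⟨K, n, (2 + a + a') * ℓ, L, ⌈γ * L⌉₊, ⌊(1 - γ) * L⌋₊⟩) hα
      hn2 hε hε1 hδ hD hγ.le hKNγ.le hKc hB hprec hβ hf⟩
  · push_cast
    linarith
  · push_cast
    linarith
  · calc L ^ 2 ≤ (2 ^ ℓ) ^ 2 := Nat.pow_le_pow_left hLℓ 2
      _ = 2 ^ (ℓ * 2) := by rw [pow_mul]
      _ ≤ 2 ^ ((2 + a + a') * ℓ) := Nat.pow_le_pow_right (by norm_num)
          ((mul_comm ℓ 2).trans_le (Nat.mul_le_mul_right _ (by omega)))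
  · exact (unifProb_hashWord
      ⟨K, n, (2 + a + a') * ℓ, L, ⌈γ * L⌉₊, ⌊(1 - γ) * L⌋₊⟩ j i fun w => w = v).trans
      (unifProb_eq_apply v)
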